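/- Let $\Sigma$ be a finite alphabet with $q\ge 2$ symbols. Let $\mathcal F=\{a_1,\dots,a_s\}$ be a finite collection of words over $\Sigma$ of length at least $2$ which is reduced (no word in it is a subword of another one), and let $\Sigma_{\mathcal F}\subseteq\Sigma^{\mathbb N}$ be the set of one-sided sequences in which no word of $\mathcal F$ occurs. A word is allowed if it is a subword of some sequence in $\Sigma_{\mathcal F}$; $\mathcal L_n$ is the set of allowed words of length $n$. Assume that every symbol is allowed. Let $\mathcal R=\{r_1,\dots,r_\ell\}$ be a reduced collection of allowed words, with assigned multiplicities $m_1,\dots,m_\ell\in\mathbb Z_{\ge 2}$. Let $\mathcal F\cup\mathcal R\neq\emptyset$, let $p\ge 2$ be the length of the longest word in $\mathcal F\cup\mathcal R$, and assume that all words in $\mathcal R$ have length $p$. For an allowed word $w$ put $m(w)=\prod_i m_i^{n(w;r_i)}$, where $n(w;r_i)$ is the number of occurrences of $r_i$ as a subword of $w$, and for an allowed word $v=v_1\cdots v_n$ put $k(v)=m(v)/m(v_2\cdots v_n)$. Let $A$ be the matrix indexed by $\mathcal L_{p-1}$ with $A_{XY}=k(X*Y)$ if $x_2\cdots x_{p-1}=y_1\cdots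 y_{p-2}$ and $X*Y:=x_1\cdots x_{p-1}y_{p-1}\in\mathcal L_p$, and $A_{XY}=0$ otherwise. (Since all words of $\mathcal R$ have length $p$, here $k(X*Y)=m(X*Y)$.) Assume that $A$ is irreducible, that is, for all $X,Y$ there is $n\ge 1$ with $(A^n)_{XY}>0$, and let $\theta$ be its Perron root (its spectral radius). For words $u,v$ let $(u,v)_z=\sum_{i=1}^{|u|}c_i z^{|u|-i}$, where $c_i=1$ if the suffix of $u$ starting at its $i$-th symbol and the word $v$ agree on their overlap (one is a prefix of the other), and $c_i=0$ otherwise. Let $w_i=r_i$ for $1\le i\le\ell$ and $w_{\ell+j}=a_j$ for $1\le j\le s$. Let $D(z)$ be the diagonal matrix with entries $D_{ii}(z)=z(1-\tfrac1{m_i})$ for $1\le i\le\ell$ and $D_{ii}(z)=-z$ for $\ell<i\le\ell+s$; let $$P(z)_{ij}=D_{jj}(z)\,(w_j,w_i)_z-\varepsilon_{ij}\,z^{|w_i|},\qquad \varepsilon_{ij}=\begin{cases}1,& i=j\le\ell\\0,&\text{otherwise,}\end{cases}$$ and $Q(z)=D(z)^{-1}P(z)^{T}D(z)$. Let $R_i(z)$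 and $S_i(z)$ be the $i$-th row sums of $P(z)^{-1}$ and $Q(z)^{-1}$. For $X\in\mathcal L_{p-1}$ define $$U_X=1-\theta\sum_{i=1}^{\ell}\Bigl(1-\frac1{m_i}\Bigr)R_i(\theta)(\tilde r_i,X)_\theta+\theta\sum_{j=1}^{s}R_{\ell+j}(\theta)(\tilde a_j,X)_\theta,$$ $$V_X=1-\theta\sum_{i=1}^{\ell}\Bigl(1-\frac1{m_i}\Bigr)S_i(\theta)(X,r_i)_\theta+\theta\sum_{j=1}^{s}S_{\ell+j}(\theta)(X,a_j)_\theta,$$ where $\tilde w$ is $w$ with its first symbol removed. Then $P(\theta)$ and $Q(\theta)$ are invertible, so that $R_i(\theta)$ and $S_i(\theta)$ exist, and $U=(U_X)_{X\in\mathcal L_{p-1}}$ and $V=(V_X)_{X\in\mathcal L_{p-1}}$ are respectively left and right Perron eigenvectors of $A$: all their entries are positive, $U^{T}A=\theta U^{T}$ and $AV=\theta V$. -/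

import Mathlib

namespace RepeatedShift

/-- The block `x k, x (k+1), …, x (k+n-1)` of the one-sided sequence `x`. -/
def block {α : Type*} (x : ℕ → α) (k n : ℕ) : List α :=
  List.ofFn fun i : Fin n => x (k + i)

/-- The subshift of finite type: one-sided sequences in which no forbidden word `a i` occurs. -/
def subshift {α ι : Type*} (a : ι → List α) : Set (ℕ → α) :=
  {x | ∀ i k, block x k (a i).length ≠ a i}

/-- The allowed words of length `n`: the blocks of length `n` of points of the subshift. -/
def language {α ι : Type*} (a : ι → List α) (n : ℕ) : Set (List α) :=
  {w | w.length = n ∧ ∃ x ∈ subshift a, ∃ k, block x k n = w}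

/-- A word is allowed if it is a subword of some point of the subshift. -/
def IsAllowed {α ι : Type*} (a : ι → List α) (w : List α) : Prop :=
  w ∈ language a w.length

/-- A collection of words is reduced if no member is a subword of another one. -/
def IsReduced {α ι : Type*} (w : ι → List α) : Prop :=
  ∀ i j, i ≠ j → ¬ w i <:+: w j

theorem language_finite {α ι : Type*} [Finite α] (a : ι → List α) (n : ℕ) :
    (language a n).Finite :=
  (List.finite_length_eq α n).subset fun _ hw => hw.1

noncomputable instance {α ι : Type*} [Finite α] (a : ι → List α) (n : ℕ) :
    Fintype (language a n) :=
  (language_finite a n).fintype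

/-- The number of positions at which the (nonempty) word `r` occurs as a subword of `w`. -/
def occurrences {α : Type*} [DecidableEq α] (w r : List α) : ℕ :=
  ((Finset.range w.length).filter fun i => r <+: w.drop i).card

open Classical in
/-- The multiplicity of a word, for the forbidden words `a` and the repeated words `r j` with
assigned multiplicities `m j`. -/
noncomputable def multiplicity {α ι κ : Type*} [Fintype κ] [DecidableEq α]
    (a : ι → List α) (r : κ → List α) (m : κ → ℕ) (w : List α) : ℕ :=
  if IsAllowed a w then ∏ j, m j ^ occurrences w (r j) else 0

/-- `k(v) = m(v) / m(v₂ ⋯ vₙ)`. For an allowed word `v` this is an exact division by a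
nonzero number, as every occurrence in the tail of `v` is an occurrence in `v`. -/
noncomputable def relMultiplicity {α ι κ : Type*} [Fintype κ] [DecidableEq α]
    (a : ι → List α) (r : κ → List α) (m : κ → ℕ) (v : List α) : ℕ :=
  multiplicity a r m v / multiplicity a r m v.tail

/-- `X * Y`: the word `X` followed by the last symbol of `Y`. -/
def star {α : Type*} (X Y : List α) : List α :=
  X ++ Y.drop (Y.length - 1)

open Classical in
/-- The adjacency matrix associated with the forbidden words `a` and the repeated words `r`
of multiplicities `m`; `X * Y` is defined when `X.tail = Y.dropLast`. -/
noncomputable def adjacency {α ι κ : Type*} [Fintype κ] [DecidableEq α]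
    (a : ι → List α) (r : κ → List α) (m : κ → ℕ) (p : ℕ) :
    Matrix (language a (p - 1)) (language a (p - 1)) ℝ :=
  Matrix.of fun X Y =>
    if (X : List α).tail = (Y : List α).dropLast ∧ star (X : List α) Y ∈ language a p then
      (relMultiplicity a r m (star (X : List α) Y) : ℝ)
    else 0

/-- The Perron root of a nonnegative real matrix: its spectral radius, the largest modulus of
a complex eigenvalue. -/
noncomputable def perronRoot {n : Type*} [Fintype n] [DecidableEq n] (A : Matrix n n ℝ) : ℝ :=
  (spectralRadius ℂ (A.map (fun t : ℝ => (t : ℂ)))).toReal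

/-- The correlation polynomial `(u, v)_z = ∑ᵢ cᵢ z ^ (|u| - i)`, `1 ≤ i ≤ |u|`. With indices
shifted to start at `0`, the bit at `i` is `1` when the suffix of `u` starting at `i` and the word
`v` agree on their overlap, i.e. when one of them is a prefix of the other. -/
def correlation {α : Type*} [DecidableEq α] (u v : List α) (z : ℝ) : ℝ :=
  ∑ i ∈ Finset.range u.length,
    if u.drop i <+: v ∨ v <+: u.drop i then z ^ (u.length - 1 - i) else 0

section Matrices

variable {α : Type*} [DecidableEq α] {s ℓ : ℕ}

/-- The matrix `P(z)`; the indices `inl` stand for repeated words, `inr` for forbidden words. -/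
noncomputable def matP (a : Fin s → List α) (r : Fin ℓ → List α) (m : Fin ℓ → ℕ) (z : ℝ) :
    Matrix (Fin ℓ ⊕ Fin s) (Fin ℓ ⊕ Fin s) ℝ :=
  Matrix.fromBlocks
    (Matrix.of fun i j => z * (1 - 1 / (m j : ℝ)) * correlation (r j) (r i) z
      - if i = j then z ^ (r j).length else 0)
    (Matrix.of fun i j => -z * correlation (a j) (r i) z)
    (Matrix.of fun i j => z * (1 - 1 / (m j : ℝ)) * correlation (r j) (a i) z)
    (Matrix.of fun i j => -z * correlation (a j) (a i) z)

/-- The diagonal matrix `D(z)`. -/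
noncomputable def matD (s : ℕ) (m : Fin ℓ → ℕ) (z : ℝ) :
    Matrix (Fin ℓ ⊕ Fin s) (Fin ℓ ⊕ Fin s) ℝ :=
  Matrix.diagonal (Sum.elim (fun i => z * (1 - 1 / (m i : ℝ))) (fun _ => -z))

/-- The matrix `Q(z) = D(z)⁻¹ P(z)ᵀ D(z)`. -/
noncomputable def matQ (a : Fin s → List α) (r : Fin ℓ → List α) (m : Fin ℓ → ℕ) (z : ℝ) :
    Matrix (Fin ℓ ⊕ Fin s) (Fin ℓ ⊕ Fin s) ℝ :=
  (matD s m z)⁻¹ * (matP a r m z).transpose * matD s m z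

/-- `R i` is the sum of row `i` of `P(z)⁻¹`. -/
noncomputable def rowR (a : Fin s → List α) (r : Fin ℓ → List α) (m : Fin ℓ → ℕ) (z : ℝ)
    (i : Fin ℓ ⊕ Fin s) : ℝ :=
  ∑ j, (matP a r m z)⁻¹ i j

/-- `S i` is the sum of row `i` of `Q(z)⁻¹`. -/
noncomputable def rowS (a : Fin s → List α) (r : Fin ℓ → List α) (m : Fin ℓ → ℕ) (z : ℝ)
    (i : Fin ℓ ⊕ Fin s) : ℝ :=
  ∑ j, (matQ a r m z)⁻¹ i j

/-- The vector `U`, evaluated at `z`; `w.tail` is `w` without its first symbol. -/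
noncomputable def vecU (a : Fin s → List α) (r : Fin ℓ → List α) (m : Fin ℓ → ℕ) (z : ℝ)
    (X : List α) : ℝ :=
  1 - z * ∑ i, (1 - 1 / (m i : ℝ)) * rowR a r m z (Sum.inl i) * correlation (r i).tail X z
    + z * ∑ j, rowR a r m z (Sum.inr j) * correlation (a j).tail X z

/-- The vector `V`, evaluated at `z`. -/
noncomputable def vecV (a : Fin s → List α) (r : Fin ℓ → List α) (m : Fin ℓ → ℕ) (z : ℝ)
    (X : List α) : ℝ :=
  1 - z * ∑ i, (1 - 1 / (m i : ℝ)) * rowS a r m z (Sum.inl i) * correlation X (r i) z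
    + z * ∑ j, rowS a r m z (Sum.inr j) * correlation X (a j) z

end Matrices

end RepeatedShift

/-!
For coefficients `d` and a constant `κ`, consider the potential `κ - ∑ⱼ dⱼ (X, wⱼ)_z` on words `X`.
If no `wⱼ` occurs in `X`, the potentials of the words `X y`, with `y` a symbol, add up to `z` times
that of `X`, plus a constant. The linear systems behind `P(z)` and `Q(z)` say exactly that the
potential is balanced: removing the first symbol from `X y` leaves its potential unchanged, except
that completing a repeated word divides it by the multiplicity, and that the potential vanishes when
a forbidden word is completed. The recursion thereby becomes the eigenvector equation up to the
constant. The entries of `V` are such a potential, those of `U` are one for the reversed words, and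
the constant vanishes by pairing `U` with a positive right eigenvector of `A`.

By irreducibility, an eigenvector for the Perron root is zero or of constant sign. Since
`z` times a potential is the sum of the potentials of the extensions, the sign propagates from the
words of length `p - 1` down to the empty word, whose potential is `κ`. With `κ = 1` this makes `U`
and `V` positive. A kernel vector of `P(θ)` gives a balanced potential with `κ = 0`, which therefore
vanishes on all words, and so do its coefficients: `P(θ)` is invertible.
-/

namespace RepeatedShift

section Perron

open Filter Matrix

variable {n : Type*} [Fintype n] {A : Matrix n n ℝ} {t : ℝ} {x y v : n → ℝ}

theorem mulVec_mono (hA : ∀ i j, 0 ≤ A i j) (hxy : x ≤ y) : A *ᵥ x ≤ A *ᵥ y :=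
  fun i => dotProduct_le_dotProduct_of_nonneg_left hxy (hA i)

theorem mulVec_pos (hA : ∀ i j, 0 < A i j) (hx : 0 ≤ x) (hx0 : x ≠ 0) (i : n) :
    0 < (A *ᵥ x) i := by
  obtain ⟨j, hj⟩ := Function.ne_iff.1 hx0
  exact Finset.sum_pos' (fun k _ => mul_nonneg (hA i k).le (hx k))
    ⟨j, Finset.mem_univ j, mul_pos (hA i j) ((hx j).lt_of_ne' hj)⟩

theorem norm_smul_norm_le_mulVec_norm {𝕜 : Type*} [RCLike 𝕜] (hA : ∀ i j, 0 ≤ A i j)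
    {μ : 𝕜} {x : n → 𝕜} (hx : A.map (algebraMap ℝ 𝕜) *ᵥ x = μ • x) :
    (‖μ‖ • fun i => ‖x i‖) ≤ A *ᵥ fun i => ‖x i‖ := fun i => by
  calc ‖μ‖ * ‖x i‖ = ‖∑ j, (algebraMap ℝ 𝕜 (A i j)) * x j‖ := by
        rw [← norm_mul]
        exact congrArg norm (congrFun hx i).symm
    _ ≤ ∑ j, ‖algebraMap ℝ 𝕜 (A i j) * x j‖ := norm_sum_le _ _
    _ = ∑ j, A i j * ‖x j‖ := Finset.sum_congr rfl fun j _ => by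
        rw [norm_mul, norm_algebraMap', Real.norm_of_nonneg (hA i j)]

theorem const_eq_zero_of_vecMul_eq [Nonempty n] {w : n → ℝ} {κ : ℝ} (hv : ∀ i, 0 < v i)
    (htv : A *ᵥ v = t • v) (hw : w ᵥ* A = t • w + Function.const n κ) : κ = 0 := by
  have h := dotProduct_mulVec w A v
  rw [htv, hw, add_dotProduct, smul_dotProduct, dotProduct_smul, left_eq_add] at h
  simp only [dotProduct, Function.const_apply, ← Finset.mul_sum] at h
  exact (mul_eq_zero.1 h).resolve_right
    (Finset.sum_pos (fun i _ => hv i) Finset.univ_nonempty).ne'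

theorem exists_commute_forall_pos (hA : A.IsIrreducible) :
    ∃ B : Matrix n n ℝ, Commute A B ∧ ∀ i j, 0 < B i j := by
  classical
  choose k _ hpos using (isIrreducible_iff_exists_pow_pos hA.nonneg).1 hA
  refine ⟨∑ a, ∑ b, (A ^ k a b : Matrix n n ℝ), Commute.sum_right _ _ _ fun a _ =>
    Commute.sum_right _ _ _ fun b _ => Commute.self_pow A _, fun i j => ?_⟩
  have hnonneg (a b : n) : 0 ≤ (A ^ k a b) i j := pow_apply_nonneg hA.nonneg (k a b) i j
  simp only [Matrix.sum_apply]
  exact Finset.sum_pos' (fun a _ => Finset.sum_nonneg fun b _ => hnonneg a b) ⟨i,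
    Finset.mem_univ i, Finset.sum_pos' (fun b _ => hnonneg i b) ⟨j, Finset.mem_univ j, hpos i j⟩⟩

theorem pow_mulVec_eq_smul [DecidableEq n] (hx : A *ᵥ x = t • x) (k : ℕ) :
    A ^ k *ᵥ x = t ^ k • x := by
  induction k with
  | zero => simp only [pow_zero, one_mulVec, one_smul]
  | succ k ih => rw [pow_succ, ← mulVec_mulVec, hx, mulVec_smul, ih, smul_smul, pow_succ']

theorem pos_of_mulVec_eq_smul (hA : A.IsIrreducible) (ht : 0 ≤ t) (hx : 0 ≤ x) (hx0 : x ≠ 0)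
    (htx : A *ᵥ x = t • x) : 0 < t ∧ ∀ i, 0 < x i := by
  classical
  obtain ⟨j, hj⟩ := Function.ne_iff.1 hx0
  have hpos (i : n) : ∃ k > 0, 0 < t ^ k * x i := by
    obtain ⟨k, hk, hij⟩ := (isIrreducible_iff_exists_pow_pos hA.nonneg).1 hA i j
    refine ⟨k, hk, ?_⟩
    rw [← smul_eq_mul, ← Pi.smul_apply, ← pow_mulVec_eq_smul htx]
    exact Finset.sum_pos' (fun b _ => mul_nonneg (pow_apply_nonneg hA.nonneg k i b) (hx b))
      ⟨j, Finset.mem_univ j, mul_pos hij ((hx j).lt_of_ne' hj)⟩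
  refine ⟨ht.lt_of_ne' ?_, fun i => ?_⟩
  · rintro rfl
    obtain ⟨k, hk, hlt⟩ := hpos j
    simp only [zero_pow hk.ne', zero_mul, lt_irrefl] at hlt
  · obtain ⟨k, -, hlt⟩ := hpos i
    exact pos_of_mul_pos_right hlt (pow_nonneg ht k)

variable [DecidableEq n]

theorem pow_smul_le_pow_mulVec (hA : ∀ i j, 0 ≤ A i j) (ht : 0 ≤ t) (hx : t • x ≤ A *ᵥ x)
    (k : ℕ) : t ^ k • x ≤ A ^ k *ᵥ x := by
  induction k with
  | zero => simp only [pow_zero, one_mulVec, one_smul, le_refl]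
  | succ k ih =>
    calc t ^ (k + 1) • x = t ^ k • t • x := by rw [smul_smul, pow_succ]
      _ ≤ t ^ k • A *ᵥ x := smul_le_smul_of_nonneg_left hx (pow_nonneg ht k)
      _ = A *ᵥ (t ^ k • x) := (mulVec_smul A _ x).symm
      _ ≤ A *ᵥ (A ^ k *ᵥ x) := mulVec_mono hA ih
      _ = A ^ (k + 1) *ᵥ x := by rw [mulVec_mulVec, pow_succ']

section Gelfand

attribute [local instance] Matrix.linftyOpNormedRing Matrix.linftyOpNormedAlgebra

theorem spectralRadius_ne_top (B : Matrix n n ℂ) : spectralRadius ℂ B ≠ ⊤ :=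
  ((spectrum.spectralRadius_le_pow_nnnorm_pow_one_div ℂ B 0).trans_lt
    (by simp [ENNReal.mul_lt_top_iff])).ne

theorem norm_map_ofReal (B : Matrix n n ℝ) : ‖B.map ((↑) : ℝ → ℂ)‖ = ‖B‖ := by
  simp only [linfty_opNorm_def, map_apply, Complex.nnnorm_real]

theorem pow_le_norm_pow (hA : ∀ i j, 0 ≤ A i j) (ht : 0 ≤ t) (hx : 0 ≤ x) (hx0 : x ≠ 0)
    (htx : t • x ≤ A *ᵥ x) (k : ℕ) : t ^ k ≤ ‖A ^ k‖ := by
  have hle : ‖t ^ k • x‖ ≤ ‖A ^ k *ᵥ x‖ := by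
    refine (pi_norm_le_iff_of_nonneg (norm_nonneg _)).2 fun i => ?_
    refine le_trans ?_ (norm_le_pi_norm (A ^ k *ᵥ x) i)
    exact abs_le_abs_of_nonneg
      (mul_nonneg (pow_nonneg ht k) (hx i)) (pow_smul_le_pow_mulVec hA ht htx k i)
  rw [norm_smul, norm_pow, Real.norm_of_nonneg ht] at hle
  exact le_of_mul_le_mul_right (hle.trans (linfty_opNorm_mulVec _ _)) (norm_pos_iff.2 hx0)

-- Iterating gives `t ^ k ≤ ‖A ^ k‖`, and Gelfand's formula takes `k`-th roots to the limit.
theorem le_perronRoot (hA : ∀ i j, 0 ≤ A i j) (ht : 0 ≤ t) (hx : 0 ≤ x) (hx0 : x ≠ 0)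
    (htx : t • x ≤ A *ᵥ x) : t ≤ perronRoot A := by
  refine ENNReal.toReal_ofReal ht ▸ ENNReal.toReal_mono (spectralRadius_ne_top _) ?_
  refine ge_of_tendsto (spectrum.pow_norm_pow_one_div_tendsto_nhds_spectralRadius _)
    ((eventually_ne_atTop 0).mono fun k hk => ENNReal.ofReal_le_ofReal ?_)
  calc t = (t ^ k) ^ (1 / k : ℝ) := by rw [one_div, Real.pow_rpow_inv_natCast ht hk]
    _ ≤ ‖A ^ k‖ ^ (1 / k : ℝ) := by
        gcongr
        exact pow_le_norm_pow hA ht hx hx0 htx k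
    _ = ‖A.map ((↑) : ℝ → ℂ) ^ k‖ ^ (1 / k : ℝ) := by
        rw [← norm_map_ofReal, ← Complex.coe_algebraMap, Matrix.map_pow]

theorem exists_eigenvector_norm_eq_perronRoot [Nonempty n] (A : Matrix n n ℝ) :
    ∃ (μ : ℂ) (x : n → ℂ), ‖μ‖ = perronRoot A ∧ x ≠ 0 ∧
      A.map (algebraMap ℝ ℂ) *ᵥ x = μ • x := by
  obtain ⟨μ, hμ, hnorm⟩ := spectrum.exists_nnnorm_eq_spectralRadius (A.map (algebraMap ℝ ℂ))
  rw [← spectrum_toLin', ← Module.End.hasEigenvalue_iff_mem_spectrum] at hμ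
  obtain ⟨x, hx⟩ := hμ.exists_hasEigenvector
  refine ⟨μ, x, ?_, hx.2, hx.apply_eq_smul⟩
  exact congrArg ENNReal.toReal hnorm

end Gelfand

theorem perronRoot_nonneg (A : Matrix n n ℝ) : 0 ≤ perronRoot A := ENNReal.toReal_nonneg

theorem perronRoot_transpose (A : Matrix n n ℝ) : perronRoot Aᵀ = perronRoot A := by
  have hspec (B : Matrix n n ℂ) : spectrum ℂ Bᵀ = spectrum ℂ B := Set.ext fun μ => by
    rw [mem_spectrum_iff_isRoot_charpoly, mem_spectrum_iff_isRoot_charpoly, charpoly_transpose]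
  simp only [perronRoot, spectralRadius, transpose_map, hspec]

-- If `A x - ρ x` were nonzero, a positive matrix `B` commuting with `A` would turn it into a
-- strict inequality `ρ (B x) < A (B x)`, which leaves room for a larger factor than `ρ`.
theorem mulVec_eq_perronRoot_smul_of_le (hA : A.IsIrreducible) (hx : 0 ≤ x)
    (hle : perronRoot A • x ≤ A *ᵥ x) : A *ᵥ x = perronRoot A • x := by
  obtain ⟨B, hAB, hB⟩ := exists_commute_forall_pos hA
  by_contra hne
  have hx0 : x ≠ 0 := by
    rintro rfl
    simp only [mulVec_zero, smul_zero, not_true_eq_false] at hne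
  obtain ⟨i₁, -⟩ := Function.ne_iff.1 hx0
  have hBx := mulVec_pos hB hx hx0
  have hgap : ∀ i, 0 < (A *ᵥ (B *ᵥ x) - perronRoot A • B *ᵥ x) i := by
    rw [mulVec_mulVec, hAB.eq, ← mulVec_mulVec, ← mulVec_smul, ← mulVec_sub]
    exact mulVec_pos hB (sub_nonneg.2 hle) (sub_ne_zero.2 hne)
  obtain ⟨i₀, -, hmin⟩ := Finset.exists_min_image Finset.univ
    (fun i => (A *ᵥ (B *ᵥ x) - perronRoot A • B *ᵥ x) i / (B *ᵥ x) i) ⟨i₁, Finset.mem_univ i₁⟩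
  set ε := (A *ᵥ (B *ᵥ x) - perronRoot A • B *ᵥ x) i₀ / (B *ᵥ x) i₀
  have hε : 0 < ε := div_pos (hgap i₀) (hBx i₀)
  have hstrict : (perronRoot A + ε) • B *ᵥ x ≤ A *ᵥ (B *ᵥ x) := fun i => by
    have hi := (le_div_iff₀ (hBx i)).1 (hmin i (Finset.mem_univ i))
    simp only [Pi.sub_apply, Pi.smul_apply, smul_eq_mul] at hi ⊢
    linarith
  have := le_perronRoot hA.nonneg (add_nonneg (perronRoot_nonneg A) hε.le)
    (fun i => (hBx i).le) (Function.ne_iff.2 ⟨i₁, (hBx i₁).ne'⟩) hstrict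
  linarith

theorem mulVec_norm_eq_perronRoot_smul {𝕜 : Type*} [RCLike 𝕜] (hA : A.IsIrreducible) {μ : 𝕜}
    {x : n → 𝕜} (hμ : ‖μ‖ = perronRoot A) (hx : A.map (algebraMap ℝ 𝕜) *ᵥ x = μ • x) :
    (A *ᵥ fun i => ‖x i‖) = perronRoot A • fun i => ‖x i‖ :=
  mulVec_eq_perronRoot_smul_of_le hA (fun i => norm_nonneg (x i))
    (hμ ▸ norm_smul_norm_le_mulVec_norm hA.nonneg hx)

theorem exists_pos_perronRoot_eigenvector [Nonempty n] (hA : A.IsIrreducible) :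
    0 < perronRoot A ∧ ∃ x : n → ℝ, (∀ i, 0 < x i) ∧ A *ᵥ x = perronRoot A • x := by
  obtain ⟨μ, x, hμ, hx0, hx⟩ := exists_eigenvector_norm_eq_perronRoot A
  have heig := mulVec_norm_eq_perronRoot_smul hA hμ hx
  have hne : (fun i => ‖x i‖) ≠ 0 := fun h => hx0 (funext fun i => norm_eq_zero.1 (congrFun h i))
  obtain ⟨hpos, hxpos⟩ := pos_of_mulVec_eq_smul hA (perronRoot_nonneg A)
    (fun i => norm_nonneg (x i)) hne heig
  exact ⟨hpos, _, hxpos, heig⟩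

theorem perronRoot_eigenvector_trichotomy (hA : A.IsIrreducible) {w : n → ℝ}
    (hw : A *ᵥ w = perronRoot A • w) : w = 0 ∨ (∀ i, 0 < w i) ∨ ∀ i, w i < 0 := by
  have hθ := perronRoot_nonneg A
  have habs : (A *ᵥ fun i => ‖w i‖) = perronRoot A • fun i => ‖w i‖ :=
    mulVec_norm_eq_perronRoot_smul (𝕜 := ℝ) hA (Real.norm_of_nonneg hθ) hw
  have hsum : A *ᵥ (w + fun i => ‖w i‖) = perronRoot A • (w + fun i => ‖w i‖) := by
    rw [mulVec_add, hw, habs, smul_add]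
  have hsum_nonneg : 0 ≤ w + fun i => ‖w i‖ := fun i => by
    simpa using neg_le_iff_add_nonneg.1 (neg_abs_le (w i))
  refine or_iff_not_imp_left.2 fun hw0 => ?_
  have hne (i : n) : w i ≠ 0 := fun hi => (pos_of_mulVec_eq_smul hA hθ
    (fun i => norm_nonneg (w i)) (fun h => hw0 (funext fun i => norm_eq_zero.1 (congrFun h i)))
    habs |>.2 i).ne' (norm_eq_zero.2 hi)
  by_cases hsum0 : w + (fun i => ‖w i‖) = 0
  · right
    intro i
    have hi : w i + |w i| = 0 := congrFun hsum0 i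
    exact (by linarith [abs_nonneg (w i)] : w i ≤ 0).lt_of_ne (hne i)
  · left
    intro i
    have hi : 0 < w i + |w i| := (pos_of_mulVec_eq_smul hA hθ hsum_nonneg hsum0 hsum).2 i
    by_contra! hneg
    rw [abs_of_nonpos hneg, add_neg_cancel] at hi
    exact hi.false

theorem perronRoot_left_eigenvector_trichotomy (hA : A.IsIrreducible) {w : n → ℝ}
    (hw : w ᵥ* A = perronRoot A • w) : w = 0 ∨ (∀ i, 0 < w i) ∨ ∀ i, w i < 0 :=
  perronRoot_eigenvector_trichotomy hA.transpose
    (by rwa [perronRoot_transpose, mulVec_transpose])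

end Perron

section Correlation

variable {α : Type*} {u v : List α}

theorem concat_prefix_or_prefix_iff (hv : ¬ v <:+: u) (y : α) :
    (u ++ [y] <+: v ∨ v <+: u ++ [y]) ↔ u ++ [y] <+: v := by
  refine or_iff_left_of_imp fun h => ?_
  rcases List.prefix_concat_iff.1 h with rfl | h
  · exact List.prefix_rfl
  · exact absurd h.isInfix hv

variable [DecidableEq α]

theorem correlation_nil (v : List α) (z : ℝ) : correlation [] v z = 0 := Finset.sum_range_zero _

theorem correlation_cons (x : α) (u v : List α) (z : ℝ) :
    correlation (x :: u) v z =
      (if x :: u <+: v ∨ v <+: x :: u then z ^ u.length else 0) + correlation u v z := by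
  simp only [correlation, List.length_cons, Finset.sum_range_succ', List.drop_zero,
    List.drop_succ_cons, Nat.add_sub_cancel, Nat.sub_zero, Nat.sub_add_eq, Nat.sub_right_comm,
    add_comm]

-- If `u` is a proper prefix of `v`, exactly one symbol continues `u` along `v`.
theorem sum_ite_concat_prefix [Fintype α] (hv : ¬ v <:+: u) (t : ℝ) :
    ∑ y, (if u ++ [y] <+: v ∨ v <+: u ++ [y] then t else 0) =
      if u <+: v ∨ v <+: u then t else 0 := by
  simp only [concat_prefix_or_prefix_iff hv]
  by_cases hu : u <+: v
  · rw [if_pos (Or.inl hu)]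
    obtain ⟨_ | ⟨c, v'⟩, rfl⟩ := hu
    · exact absurd (by rw [List.append_nil]) hv
    · simp only [List.prefix_append_right_inj, List.cons_prefix_cons, List.nil_prefix, and_true,
        Finset.sum_ite_eq', Finset.mem_univ, if_true]
  · rw [if_neg (not_or.2 ⟨hu, fun h => hv h.isInfix⟩)]
    exact Finset.sum_eq_zero fun y _ => if_neg fun h => hu ((List.prefix_append _ _).trans h)

theorem sum_correlation_concat [Fintype α] (hv : ¬ v <:+: u) (z : ℝ) :
    ∑ y, correlation (u ++ [y]) v z = z * correlation u v z + 1 := by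
  induction u with
  | nil =>
    have h := sum_ite_concat_prefix hv 1
    simp only [List.nil_append, List.nil_prefix, true_or, if_true] at h
    simpa only [List.nil_append, correlation_cons, correlation_nil, List.length_nil, pow_zero,
      add_zero, mul_zero, zero_add] using h
  | cons x u ih =>
    have h := sum_ite_concat_prefix hv (z ^ (u.length + 1))
    simp only [List.cons_append] at h
    simp only [List.cons_append, correlation_cons, Finset.sum_add_distrib,
      ih fun h => hv (List.infix_cons h), List.length_append, List.length_singleton, h]
    split_ifs <;> ring

/-- The part of the correlation polynomial `(u, v)_z` in which a suffix of `u` equals a prefix of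
`v`. It leaves out the positions at which `v` occurs inside `u` and `u` goes on after that, and is
therefore symmetric under reversal. -/
def overlap (u v : List α) (z : ℝ) : ℝ :=
  ∑ k ∈ Finset.range (min u.length v.length),
    if u.rtake (k + 1) = v.take (k + 1) then z ^ k else 0

theorem correlation_eq_overlap (h : v <:+: u → u.length ≤ v.length) (z : ℝ) :
    correlation u v z = overlap u v z := by
  rw [correlation, overlap, ← Finset.sum_range_reflect,
    ← Finset.sum_subset (Finset.range_subset_range.2 (min_le_left u.length v.length))]
  · refine Finset.sum_congr rfl fun k hk => ?_
    obtain ⟨hku, hkv⟩ := lt_min_iff.1 (Finset.mem_range.1 hk)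
    have hlen : (u.rtake (k + 1)).length = k + 1 := by rw [List.rtake, List.length_drop]; omega
    rw [Nat.sub_sub_self (by omega), Nat.sub_right_comm, Nat.sub_sub, ← List.rtake]
    refine if_congr ⟨fun hagree => ?_, fun heq => Or.inl (heq ▸ List.take_prefix _ _)⟩ rfl rfl
    rcases hagree with hpre | hpre
    · rw [List.prefix_iff_eq_take.1 hpre, hlen]
    · have hv : v.length = k + 1 := by have := hpre.length_le; omega
      rw [List.take_of_length_le hv.le]
      exact (hpre.eq_of_length (hv.trans hlen.symm)).symm
  · intro k hk hk'
    rw [Finset.mem_range] at hk hk'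
    refine if_neg ?_
    rintro (hpre | hpre)
    · have := hpre.length_le
      rw [List.length_drop] at this
      omega
    · have := h (hpre.isInfix.trans (List.drop_suffix _ _).isInfix)
      omega

theorem overlap_reverse (u v : List α) (z : ℝ) :
    overlap v.reverse u.reverse z = overlap u v z := by
  simp only [overlap, List.length_reverse, List.rtake_eq_reverse_take_reverse,
    List.reverse_reverse, min_comm, List.reverse_eq_iff, eq_comm]

theorem overlap_tail (h : ¬ u <+: v) (z : ℝ) : overlap u.tail v z = overlap u v z := by
  rcases u with _ | ⟨x, u⟩
  · rfl
  refine Finset.sum_subset_zero_on_sdiff (Finset.range_subset_range.2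
    (min_le_min_right _ (Nat.le_succ u.length))) (fun k hk => if_neg fun heq => h ?_)
    fun k hk => ?_
  · simp only [Finset.mem_sdiff, Finset.mem_range, List.length_cons, List.tail_cons] at hk
    have hku : (x :: u).rtake (k + 1) = x :: u := by
      rw [List.rtake, List.length_cons, show u.length + 1 - (k + 1) = 0 by omega, List.drop_zero]
    exact hku ▸ heq ▸ List.take_prefix _ _
  · have hku : k < u.length := (lt_min_iff.1 (Finset.mem_range.1 hk)).1
    rw [List.rtake, List.rtake, List.length_cons, Nat.succ_sub hku, List.drop_succ_cons,
      List.tail_cons]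

theorem correlation_reverse (h : v <:+: u → u.length ≤ v.length)
    (h' : u <:+: v → v.length ≤ u.length) (z : ℝ) :
    correlation v.reverse u.reverse z = correlation u v z := by
  rw [correlation_eq_overlap h, ← overlap_reverse, correlation_eq_overlap]
  simpa only [List.reverse_infix, List.length_reverse] using h'

theorem correlation_tail_eq_reverse (hlen : u.length ≤ v.length + 1) (h : ¬ u <:+: v) (z : ℝ) :
    correlation u.tail v z = correlation v.reverse u.reverse z := by
  rw [correlation_eq_overlap (u := u.tail), overlap_tail (mt List.IsPrefix.isInfix h),
    ← overlap_reverse, correlation_eq_overlap]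
  · exact fun h' => absurd (List.reverse_infix.1 h') h
  · intro _
    rw [List.length_tail]
    omega

end Correlation

section Words

variable {α ι : Type*} {w : ι → List α} {X Y : List α} {x : α}

/-- No word of the family `w` occurs in `X`. Unlike membership in a language, this says nothing
about continuations of `X`. -/
def Avoids (w : ι → List α) (X : List α) : Prop :=
  ∀ i, ¬ w i <:+: X

theorem Avoids.of_infix (hY : Avoids w Y) (h : X <:+: Y) : Avoids w X :=
  fun i hi => hY i (hi.trans h)

theorem Avoids.tail (hX : Avoids w X) : Avoids w X.tail := hX.of_infix (List.tail_suffix X).isInfix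

theorem Avoids.dropLast (hX : Avoids w X) : Avoids w X.dropLast :=
  hX.of_infix (List.dropLast_prefix X).isInfix

theorem avoids_reverse_iff : Avoids (List.reverse ∘ w) X.reverse ↔ Avoids w X := by
  simp only [Avoids, Function.comp_apply, List.reverse_infix]

theorem Avoids.suffix_of_infix_concat {i : ι} (hX : Avoids w X) (hi : w i <:+: X ++ [x]) :
    w i <:+ X ++ [x] :=
  (List.infix_concat_iff.1 hi).resolve_right (hX i)

variable {μ : ι → ℝ}

/-- A reduced family of words of length at most `p` with nonnegative weights, in which
only the words of full length `p` have a nonzero weight. The words of weight `0` are the forbidden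
ones, the others are the repeated ones. -/
structure IsWeightedFamily (w : ι → List α) (μ : ι → ℝ) (p : ℕ) : Prop where
  pos : 0 < p
  ne_nil : ∀ i, w i ≠ []
  length_le : ∀ i, (w i).length ≤ p
  length_eq : ∀ i, μ i ≠ 0 → (w i).length = p
  reduced : ∀ i j, w i <:+: w j → i = j
  nonneg : ∀ i, 0 ≤ μ i

namespace IsWeightedFamily

variable {p : ℕ} (h : IsWeightedFamily w μ p)

include h

theorem reverse : IsWeightedFamily (List.reverse ∘ w) μ p where
  pos := h.pos
  ne_nil i := by simpa only [Function.comp_apply, ne_eq, List.reverse_eq_nil_iff] using h.ne_nil i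
  length_le i := by simpa only [Function.comp_apply, List.length_reverse] using h.length_le i
  length_eq i := by simpa only [Function.comp_apply, List.length_reverse] using h.length_eq i
  reduced i j := by simpa only [Function.comp_apply, List.reverse_infix] using h.reduced i j
  nonneg := h.nonneg

theorem avoids_nil : Avoids w [] := fun i hi => h.ne_nil i (List.infix_nil.1 hi)

theorem length_tail_lt (i : ι) : (w i).tail.length < (w i).length := by
  have := List.length_pos_iff.2 (h.ne_nil i)
  rw [List.length_tail]
  omega

theorem avoids_tail (i : ι) : Avoids w (w i).tail := fun j hj => by
  obtain rfl := h.reduced j i (hj.trans (List.tail_suffix _).isInfix)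
  exact (h.length_tail_lt j).not_ge hj.length_le

theorem eq_of_suffix {i j : ι} (hi : w i <:+ X) (hj : w j <:+ X) : i = j :=
  (List.suffix_or_suffix_of_suffix hi hj).elim (fun hij => h.reduced i j hij.isInfix)
    fun hji => (h.reduced j i hji.isInfix).symm

end IsWeightedFamily

variable [Fintype ι]

open Classical in
/-- The product of the weights `μ i` of the words `w i` that occur in `v`. -/
noncomputable def weight (w : ι → List α) (μ : ι → ℝ) (v : List α) : ℝ :=
  ∏ i, if w i <:+: v then μ i else 1

theorem weight_reverse (v : List α) :
    weight (List.reverse ∘ w) μ v.reverse = weight w μ v := by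
  classical exact Finset.prod_congr rfl fun i _ => if_congr List.reverse_infix rfl rfl

theorem weight_nonneg (hμ : ∀ i, 0 ≤ μ i) (v : List α) : 0 ≤ weight w μ v :=
  Finset.prod_nonneg fun i _ => by
    split_ifs
    exacts [hμ i, zero_le_one]

theorem weight_eq_one (hX : Avoids w X) : weight w μ X = 1 :=
  Finset.prod_eq_one fun i _ => if_neg (hX i)

theorem weight_eq_zero {i : ι} (hi : w i <:+: X) (hμ : μ i = 0) : weight w μ X = 0 :=
  Finset.prod_eq_zero (Finset.mem_univ i) (by rw [if_pos hi, hμ])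

theorem IsWeightedFamily.weight_concat {p : ℕ} (h : IsWeightedFamily w μ p) {i : ι}
    (hX : Avoids w X) (hi : w i <:+ X ++ [x]) : weight w μ (X ++ [x]) = μ i := by
  classical
  rw [weight, Finset.prod_eq_single i, if_pos hi.isInfix]
  · exact fun j _ hji => if_neg fun hj => hji (h.eq_of_suffix (hX.suffix_of_infix_concat hj) hi)
  · exact fun hi => absurd (Finset.mem_univ i) hi

end Words

section Potential

variable {α ι : Type*} [Fintype ι]

/-- The constant by which a balanced potential fails to be an eigenvector for `z`. -/
def defect (α : Type*) [Fintype α] (d : ι → ℝ) (κ z : ℝ) : ℝ :=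
  (Fintype.card α - z) * κ - ∑ j, d j

theorem defect_neg [Fintype α] (d : ι → ℝ) (κ z : ℝ) :
    defect α (-d) (-κ) z = -defect α d κ z := by
  simp only [defect, Pi.neg_apply, Finset.sum_neg_distrib]
  ring

variable [DecidableEq α] {w : ι → List α} {μ d : ι → ℝ} {κ z : ℝ} {X : List α} {x : α} {p : ℕ}

/-- The common form `κ - ∑ⱼ dⱼ (X, wⱼ)_z` of the entries of `V` and, after reversal of all words,
of `U`. The constant `κ` is kept as a parameter so that the potentials of a family of words form a
vector space. -/
noncomputable def potential (w : ι → List α) (d : ι → ℝ) (κ z : ℝ) (X : List α) : ℝ :=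
  κ - ∑ j, d j * correlation X (w j) z

/-- The condition on the coefficients under which, for every word of the family, the potential is
the weight of the word times the potential left when its first symbol is removed. In matrix form
these are the linear systems that define `R` and `S`. -/
def IsBalanced (w : ι → List α) (μ d : ι → ℝ) (κ z : ℝ) : Prop :=
  ∀ i, potential w d κ z (w i) = μ i * potential w d κ z (w i).tail

theorem potential_nil (w : ι → List α) (d : ι → ℝ) (κ z : ℝ) : potential w d κ z [] = κ := by
  simp only [potential, correlation_nil, mul_zero, Finset.sum_const_zero, sub_zero]

theorem potential_neg (w : ι → List α) (d : ι → ℝ) (κ z : ℝ) (X : List α) :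
    potential w (-d) (-κ) z X = -potential w d κ z X := by
  simp only [potential, Pi.neg_apply, neg_mul, Finset.sum_neg_distrib]
  ring

theorem IsBalanced.neg (hd : IsBalanced w μ d κ z) : IsBalanced w μ (-d) (-κ) z := fun i => by
  rw [potential_neg, potential_neg, hd i, mul_neg]

theorem potential_cons (w : ι → List α) (d : ι → ℝ) (κ z : ℝ) (x : α) (X : List α) :
    potential w d κ z (x :: X) = potential w d κ z X -
      ∑ j, if x :: X <+: w j ∨ w j <+: x :: X then d j * z ^ X.length else 0 := by
  simp only [potential, correlation_cons, mul_add, Finset.sum_add_distrib, mul_ite, mul_zero]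
  ring

theorem potential_cons_eq (h : ∀ j, ¬ (x :: X <+: w j ∨ w j <+: x :: X)) :
    potential w d κ z (x :: X) = potential w d κ z X := by
  rw [potential_cons, sub_eq_self]
  exact Finset.sum_eq_zero fun j _ => if_neg (h j)

theorem sum_potential_concat [Fintype α] (d : ι → ℝ) (κ z : ℝ) (hX : Avoids w X) :
    ∑ y, potential w d κ z (X ++ [y]) = z * potential w d κ z X + defect α d κ z := by
  simp only [potential, defect, Finset.sum_sub_distrib, Finset.sum_const, Finset.card_univ,
    nsmul_eq_mul]
  rw [Finset.sum_comm]
  simp only [← Finset.mul_sum, sum_correlation_concat (hX _), mul_add, mul_one,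
    Finset.sum_add_distrib, mul_left_comm _ z]
  ring

namespace IsWeightedFamily

variable (h : IsWeightedFamily w μ p)

include h

theorem potential_word (i : ι) :
    potential w d κ z (w i) = potential w d κ z (w i).tail - d i * z ^ (w i).tail.length := by
  classical
  obtain ⟨x, X, hX⟩ := List.exists_cons_of_ne_nil (h.ne_nil i)
  rw [hX, potential_cons, ← hX, Finset.sum_eq_single i, if_pos (Or.inl List.prefix_rfl), hX,
    List.tail_cons]
  · refine fun j _ hji => if_neg ?_
    rintro (hij | hij)
    exacts [hji (h.reduced i j hij.isInfix).symm, hji (h.reduced j i hij.isInfix)]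
  · exact fun hi => absurd (Finset.mem_univ i) hi

theorem potential_concat {i : ι} (hX : Avoids w X) (hi : w i <:+ X ++ [x]) :
    potential w d κ z (X ++ [x]) = potential w d κ z (w i) := by
  induction X with
  | nil =>
    rw [List.nil_append] at hi ⊢
    rw [hi.eq_of_length_le (List.length_pos_iff.2 (h.ne_nil i))]
  | cons y X ih =>
    rcases List.suffix_cons_iff.1 hi with heq | hi'
    · exact congrArg _ heq.symm
    have hlt : (w i).length < (y :: X ++ [x]).length := Nat.lt_succ_of_le hi'.length_le
    rw [← ih (hX.of_infix (List.suffix_cons y X).isInfix) hi']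
    refine potential_cons_eq fun j => ?_
    rintro (hj | hj)
    · obtain rfl := h.reduced i j (hi.isInfix.trans hj.isInfix)
      exact hlt.not_ge hj.length_le
    · rcases (List.prefix_concat_iff (l₂ := y :: X)).1 hj with heq | hj'
      · obtain rfl := h.reduced i j (heq ▸ hi.isInfix)
        exact hlt.ne (congrArg List.length heq)
      · exact hX j hj'.isInfix

theorem weight_mul_potential_tail (hd : IsBalanced w μ d κ z) (hX : Avoids w X)
    (hlen : X.length + 1 = p) (x : α) :
    weight w μ (X ++ [x]) * potential w d κ z (X ++ [x]).tail = potential w d κ z (X ++ [x]) := by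
  have hlen' : (X ++ [x]).length = p := by rw [List.length_append, List.length_singleton, hlen]
  by_cases hav : Avoids w (X ++ [x])
  · obtain ⟨y, Y, hY⟩ := List.exists_cons_of_ne_nil (List.concat_ne_nil x X)
    rw [weight_eq_one hav, one_mul, hY, List.tail_cons]
    refine (potential_cons_eq fun j hj => hav j ?_).symm
    rw [hY]
    refine hj.elim (fun hpre => ?_) List.IsPrefix.isInfix
    exact hpre.eq_of_length_le (by rw [← hY, hlen']; exact h.length_le j) ▸ List.infix_rfl
  · simp only [Avoids, not_forall, not_not] at hav
    obtain ⟨i, hi⟩ := hav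
    have hi := hX.suffix_of_infix_concat hi
    rw [h.weight_concat hX hi, h.potential_concat hX hi, hd i]
    by_cases hμ : μ i = 0
    · rw [hμ, zero_mul, zero_mul]
    · rw [← hi.eq_of_length ((h.length_eq i hμ).trans hlen'.symm)]

theorem potential_concat_eq_zero (hd : IsBalanced w μ d κ z) (hX : Avoids w X)
    (hlen : X.length + 1 < p) (hXx : ¬ Avoids w (X ++ [x])) :
    potential w d κ z (X ++ [x]) = 0 := by
  simp only [Avoids, not_forall, not_not] at hXx
  obtain ⟨i, hi⟩ := hXx
  have hi := hX.suffix_of_infix_concat hi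
  have hμ : μ i = 0 := by
    by_contra hμ
    have := hi.length_le
    rw [h.length_eq i hμ, List.length_append, List.length_singleton] at this
    omega
  rw [h.potential_concat hX hi, hd i, hμ, zero_mul]

variable [Fintype α]

theorem sum_weight_mul_potential_tail (hd : IsBalanced w μ d κ z) (hX : Avoids w X)
    (hlen : X.length + 1 = p) :
    ∑ x, weight w μ (X ++ [x]) * potential w d κ z (X ++ [x]).tail =
      z * potential w d κ z X + defect α d κ z := by
  simp only [h.weight_mul_potential_tail hd hX hlen, sum_potential_concat d κ z hX]

theorem potential_nonneg (hd : IsBalanced w μ d κ z) (hz : 0 < z) (hdef : defect α d κ z = 0)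
    (hnonneg : ∀ X, Avoids w X → X.length + 1 = p → 0 ≤ potential w d κ z X)
    (hX : Avoids w X) (hlen : X.length < p) : 0 ≤ potential w d κ z X := by
  induction hk : p - X.length using Nat.strong_induction_on generalizing X with
  | _ k ih =>
    rcases eq_or_lt_of_le (Nat.succ_le_of_lt hlen) with heq | hlt
    · exact hnonneg X hX heq
    refine nonneg_of_mul_nonneg_right ?_ hz
    have hsum := sum_potential_concat d κ z hX
    rw [hdef, add_zero] at hsum
    rw [← hsum]
    refine Finset.sum_nonneg fun x _ => ?_
    by_cases hXx : Avoids w (X ++ [x])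
    · have hlen' : (X ++ [x]).length = X.length + 1 := List.length_append
      exact ih (p - (X ++ [x]).length) (by omega) hXx (by omega) rfl
    · exact (h.potential_concat_eq_zero hd hX hlt hXx).ge

-- `z` times a potential is the sum of the potentials of the one-letter extensions, so if these
-- are nonnegative and the sum vanishes, they all vanish.
theorem potential_eq_zero_of_nil_eq_zero (hd : IsBalanced w μ d 0 z)
    (hdef : defect α d 0 z = 0)
    (hnonneg : ∀ X, Avoids w X → X.length < p → 0 ≤ potential w d 0 z X)
    (hX : Avoids w X) (hlen : X.length < p) : potential w d 0 z X = 0 := by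
  induction X using List.reverseRecOn with
  | nil => exact potential_nil w d 0 z
  | append_singleton X x ih =>
    rw [List.length_append, List.length_singleton] at hlen
    have hX' : Avoids w X := hX.of_infix (List.prefix_append X [x]).isInfix
    have hsum : ∑ y, potential w d 0 z (X ++ [y]) = 0 := by
      rw [sum_potential_concat d 0 z hX', ih hX' (by omega), hdef, mul_zero, add_zero]
    refine (Finset.sum_eq_zero_iff_of_nonneg fun y _ => ?_).1 hsum x (Finset.mem_univ x)
    by_cases hXy : Avoids w (X ++ [y])
    · exact hnonneg _ hXy (by rwa [List.length_append, List.length_singleton])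
    · exact (h.potential_concat_eq_zero hd hX' hlen hXy).ge

theorem const_nonneg_and_eq_zero_imp (hd : IsBalanced w μ d κ z) (hz : 0 < z)
    (hdef : defect α d κ z = 0)
    (hnonneg : ∀ X, Avoids w X → X.length + 1 = p → 0 ≤ potential w d κ z X) :
    0 ≤ κ ∧ (κ = 0 → d = 0) := by
  have hshort {X : List α} := h.potential_nonneg (X := X) hd hz hdef hnonneg
  refine ⟨potential_nil w d κ z ▸ hshort h.avoids_nil h.pos, ?_⟩
  rintro rfl
  ext i
  have htail : potential w d 0 z (w i).tail = 0 :=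
    h.potential_eq_zero_of_nil_eq_zero hd hdef (fun X => hshort) (h.avoids_tail i)
      ((h.length_tail_lt i).trans_le (h.length_le i))
  have hword := h.potential_word (d := d) (κ := 0) (z := z) i
  rw [hd i, htail, mul_zero, zero_sub, eq_comm, neg_eq_zero] at hword
  exact (mul_eq_zero.1 hword).resolve_right (pow_pos hz _).ne'

end IsWeightedFamily

end Potential

section Language

variable {α ι : Type*} {a : ι → List α} {n : ℕ}

theorem length_block (x : ℕ → α) (k n : ℕ) : (block x k n).length = n :=
  List.length_ofFn

theorem block_succ (x : ℕ → α) (k n : ℕ) : block x k (n + 1) = x k :: block x (k + 1) n := by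
  simp only [block, List.ofFn_succ, Fin.val_zero, add_zero, Fin.val_succ, add_assoc, add_comm 1]

theorem block_add (x : ℕ → α) (k n l : ℕ) :
    block x k (n + l) = block x k n ++ block x (k + n) l := by
  simp only [block, List.ofFn_add, Fin.val_castLE, Fin.val_natAdd, add_assoc]

theorem block_prefix_block (x : ℕ → α) (k : ℕ) {l n : ℕ} (h : l ≤ n) :
    block x k l <+: block x k n := by
  obtain ⟨t, rfl⟩ := Nat.exists_eq_add_of_le h
  exact block_add x k l t ▸ List.prefix_append _ _

theorem exists_block_eq_of_infix {x : ℕ → α} {k : ℕ} {u : List α} (h : u <:+: block x k n) :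
    ∃ k', block x k' u.length = u := by
  obtain ⟨b, t, h⟩ := h
  have hn : n = b.length + u.length + t.length := by
    rw [← length_block x k n, ← h, List.length_append, List.length_append]
  rw [hn, block_add, block_add] at h
  have hbu := (List.append_inj' h (by rw [length_block])).1
  exact ⟨k + b.length, (List.append_inj' hbu (by rw [length_block])).2.symm⟩

theorem exists_forall_block_eq {v : ℕ → List α} (hlen : ∀ k, (v k).length = n + 1)
    (hv : ∀ k, (v k).tail = (v (k + 1)).dropLast) : ∃ x, ∀ k, block x k (n + 1) = v k := by
  induction n generalizing v with
  | zero =>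
    choose x hx using fun k => List.length_eq_one_iff.1 (hlen k)
    exact ⟨x, fun k => (hx k).symm⟩
  | succ n ih =>
    obtain ⟨x, hx⟩ := ih (v := fun k => (v k).dropLast)
      (fun k => by rw [List.length_dropLast, hlen, Nat.add_sub_cancel])
      (fun k => by rw [List.tail_dropLast, hv])
    refine ⟨x, fun k => ?_⟩
    have hk := hx k
    rw [block_succ, hx, ← hv]
    obtain ⟨c, t, hct⟩ := List.exists_cons_of_length_eq_add_one (hlen k)
    have ht : t ≠ [] := by
      rintro rfl
      simpa [hct] using hlen k
    rw [hct, List.dropLast_cons_of_ne_nil ht, block_succ] at hk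
    rw [hct, List.tail_cons, (List.cons.inj hk).1]

theorem mem_language_of_infix {u v : List α} (hv : v ∈ language a n) (h : u <:+: v) :
    u ∈ language a u.length := by
  obtain ⟨-, x, hx, k, rfl⟩ := hv
  exact ⟨rfl, x, hx, exists_block_eq_of_infix h⟩

theorem avoids_of_mem_language {v : List α} (hv : v ∈ language a n) : Avoids a v := by
  obtain ⟨-, x, hx, k, rfl⟩ := hv
  intro j hj
  obtain ⟨k', hk'⟩ := exists_block_eq_of_infix hj
  exact hx j k' hk'

theorem mem_subshift_of_avoids {x : ℕ → α} (ha : ∀ j, (a j).length ≤ n)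
    (hx : ∀ k, Avoids a (block x k n)) : x ∈ subshift a :=
  fun j k hj => hx k j (hj ▸ (block_prefix_block x k (ha j)).isInfix)

theorem cons_mem_language {x : α} {Y : List α} (ha : ∀ j, (a j).length ≤ n + 1)
    (hY : Y ∈ language a n) (h : Avoids a (x :: Y)) : x :: Y ∈ language a (n + 1) := by
  obtain ⟨hlen, ξ, hξ, k, rfl⟩ := hY
  set ζ : ℕ → α := fun i => Nat.casesOn i x fun i => ξ (k + i) with hζ
  have hblock : ∀ i l, block ζ (i + 1) l = block ξ (k + i) l := fun i l => by
    simp only [block, hζ, Nat.add_right_comm i 1, ← add_assoc]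
  have h0 : block ζ 0 (n + 1) = x :: block ξ k n := by
    rw [block_succ, hblock, add_zero]
    rfl
  refine ⟨by rw [List.length_cons, hlen], ζ, mem_subshift_of_avoids ha fun i => ?_, 0, h0⟩
  cases i with
  | zero => rwa [h0]
  | succ i => exact hblock i _ ▸ avoids_of_mem_language ⟨length_block _ _ _, ξ, hξ, _, rfl⟩

theorem tail_notMem_language (ha : ∀ j, (a j).length ≤ n + 1) {v : List α}
    (hlen : v.length = n + 1) (hv : Avoids a v) (hdrop : v.dropLast ∉ language a n) :
    v.tail ∉ language a n := by
  obtain ⟨x, Y, rfl⟩ := List.exists_cons_of_length_eq_add_one hlen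
  refine fun hY => hdrop ?_
  have := mem_language_of_infix (cons_mem_language ha hY hv)
    (List.dropLast_prefix (x :: Y)).isInfix
  rwa [List.length_dropLast, hlen, Nat.add_sub_cancel] at this

/-- `Y` arises from `X` by dropping the first symbol and appending a new one, and the word
traversed by this move avoids `a`. -/
def IsStep (a : ι → List α) (X Y : List α) : Prop :=
  ∃ v, Avoids a v ∧ v.dropLast = X ∧ v.tail = Y

/-- The words of length `n` that are not allowed, whether or not they avoid `a`. -/
abbrev NotAllowed (a : ι → List α) (n : ℕ) : Type _ :=
  {X : List α // X.length = n ∧ X ∉ language a n}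

-- An infinite sequence of steps traces out a point of the subshift.
theorem wellFounded_isStep_swap (hn : 0 < n) (ha : ∀ j, (a j).length ≤ n + 1) :
    WellFounded fun Y X : NotAllowed a n => IsStep a X Y := by
  rw [wellFounded_iff_isEmpty_descending_chain]
  refine ⟨fun ⟨X, hX⟩ => ?_⟩
  choose v hav hdrop htail using hX
  have hlen : ∀ k, (v k).length = n + 1 := fun k => by
    have := (X k).2.1
    rw [← hdrop, List.length_dropLast] at this
    omega
  obtain ⟨x, hx⟩ := exists_forall_block_eq hlen fun k => (htail k).trans (hdrop (k + 1)).symm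
  have hmem : v 0 ∈ language a (n + 1) :=
    ⟨hlen 0, x, mem_subshift_of_avoids ha fun k => hx k ▸ hav k, 0, hx 0⟩
  have := mem_language_of_infix hmem (List.dropLast_prefix _).isInfix
  rw [hdrop, (X 0).2.1] at this
  exact (X 0).2.2 this

theorem wellFounded_swap {β : Type*} [Finite β] {R : β → β → Prop} (hR : WellFounded R) :
    WellFounded (Function.swap R) := by
  have := hR.transGen.irrefl
  have : IsTrans β (Function.swap (Relation.TransGen R)) := inferInstance
  exact (Finite.wellFounded_of_trans_of_irrefl (Function.swap (Relation.TransGen R))).mono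
    fun _ _ hR => Relation.TransGen.single hR

theorem wellFounded_isStep [Finite α] (hn : 0 < n) (ha : ∀ j, (a j).length ≤ n + 1) :
    WellFounded fun X Y : NotAllowed a n => IsStep a X Y :=
  have : Finite (NotAllowed a n) :=
    ((List.finite_length_eq α n).subset fun _ hX => hX.1).to_subtype
  wellFounded_swap (wellFounded_isStep_swap hn ha)

end Language

section System

variable {α ι ι' : Type*} {a : ι → List α} {r : ι' → List α} {m : ι' → ℕ} {p : ℕ} {X v : List α}

/-- Forbidden words `a` of length at most `p` and repeated words `r` of length `p` with
multiplicities `m`. The repeated words are only required to avoid the forbidden ones, not to be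
allowed. -/
structure IsSystem (a : ι → List α) (r : ι' → List α) (m : ι' → ℕ) (p : ℕ) : Prop where
  two_le : 2 ≤ p
  ne_nil : ∀ i, a i ≠ []
  length_le : ∀ i, (a i).length ≤ p
  length_eq : ∀ j, (r j).length = p
  two_le_mult : ∀ j, 2 ≤ m j
  reduced_forbidden : IsReduced a
  reduced_repeated : IsReduced r
  avoids : ∀ j, Avoids a (r j)

/-- The weights of the repeated and of the forbidden words: a repeated word is weighted by its
multiplicity, a forbidden word by `0`. -/
def wordWeight (m : ι' → ℕ) : ι' ⊕ ι → ℝ := Sum.elim (fun j => (m j : ℝ)) 0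

namespace IsSystem

theorem length_word_le (h : IsSystem a r m p) (i : ι' ⊕ ι) : (Sum.elim r a i).length ≤ p := by
  rcases i with j | i
  exacts [(h.length_eq j).le, h.length_le i]

theorem isWeightedFamily (h : IsSystem a r m p) :
    IsWeightedFamily (Sum.elim r a) (wordWeight m) p where
  pos := zero_lt_two.trans_le h.two_le
  ne_nil := by
    rintro (j | i)
    · exact List.length_pos_iff.1 ((h.length_eq j).symm ▸ zero_lt_two.trans_le h.two_le)
    · exact h.ne_nil i
  length_le := h.length_word_le
  length_eq := by
    rintro (j | i) hμ
    exacts [h.length_eq j, absurd rfl hμ]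
  reduced := by
    rintro (j | i) (j' | i') hw
    · exact congrArg _ (not_imp_not.1 (h.reduced_repeated j j') hw)
    · have heq : r j = a i' := hw.eq_of_length_le ((h.length_le i').trans (h.length_eq j).ge)
      exact absurd (heq ▸ List.infix_rfl) (h.avoids j i')
    · exact absurd hw (h.avoids j' i)
    · exact congrArg _ (not_imp_not.1 (h.reduced_forbidden i i') hw)
  nonneg := by
    rintro (j | _)
    exacts [Nat.cast_nonneg _, le_rfl]

theorem nil_notMem_language (h : IsSystem a r m p) : [] ∉ language a p :=
  fun hnil => (zero_lt_two.trans_le h.two_le).ne hnil.1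

theorem avoids_elim (h : IsSystem a r m p) (hX : Avoids a X) (hlen : X.length < p) :
    Avoids (Sum.elim r a) X := by
  rintro (j | i)
  · exact fun hj => (hj.length_le.trans_lt hlen).ne (h.length_eq j)
  · exact hX i

end IsSystem

variable [Fintype ι] [Fintype ι']

theorem weight_eq_zero_of_not_avoids (hv : ¬ Avoids a v) :
    weight (Sum.elim r a) (wordWeight m) v = 0 := by
  simp only [Avoids, not_forall, not_not] at hv
  obtain ⟨i, hi⟩ := hv
  exact weight_eq_zero (i := Sum.inr i) hi rfl

variable [DecidableEq α]

theorem occurrences_eq_zero {u : List α} (h : ¬ u <:+: v) : occurrences v u = 0 := by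
  rw [occurrences, Finset.card_eq_zero, Finset.filter_eq_empty_iff]
  exact fun i _ hi => h (hi.isInfix.trans (List.drop_suffix i v).isInfix)

theorem occurrences_self (hv : v ≠ []) : occurrences v v = 1 := by
  rw [occurrences, Finset.card_eq_one]
  refine ⟨0, Finset.ext fun i => ?_⟩
  rw [Finset.mem_filter, Finset.mem_range, Finset.mem_singleton]
  constructor
  · rintro ⟨hi, hpre⟩
    have := hpre.length_le
    rw [List.length_drop] at this
    omega
  · rintro rfl
    exact ⟨List.length_pos_iff.2 hv, List.prefix_rfl⟩

namespace IsSystem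

variable (h : IsSystem a r m p)

include h

omit [Fintype ι] in
theorem multiplicity_eq_one (hv : IsAllowed a v) (hlen : v.length < p) :
    multiplicity a r m v = 1 := by
  rw [multiplicity, if_pos hv]
  refine Finset.prod_eq_one fun j _ => ?_
  rw [occurrences_eq_zero, pow_zero]
  exact fun hj => (hj.length_le.trans_lt hlen).ne (h.length_eq j)

theorem relMultiplicity_eq_weight (hv : v ∈ language a p) :
    (relMultiplicity a r m v : ℝ) = weight (Sum.elim r a) (wordWeight m) v := by
  have hp := h.two_le
  have hall : IsAllowed a v := by rwa [IsAllowed, hv.1]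
  have htail : multiplicity a r m v.tail = 1 :=
    h.multiplicity_eq_one (mem_language_of_infix hv (List.tail_suffix v).isInfix)
      (by rw [List.length_tail, hv.1]; omega)
  have hforbidden : ∀ i, ¬ Sum.elim r a (Sum.inr i) <:+: v := avoids_of_mem_language hv
  rw [relMultiplicity, htail, Nat.div_one, multiplicity, if_pos hall, weight,
    Fintype.prod_sum_type, Nat.cast_prod]
  simp only [hforbidden, if_false, Finset.prod_const_one, mul_one]
  refine Finset.prod_congr rfl fun j _ => ?_
  by_cases hj : r j <:+: v
  · have heq : r j = v := hj.eq_of_length (hv.1.symm ▸ h.length_eq j)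
    rw [heq, occurrences_self (heq ▸ h.isWeightedFamily.ne_nil (Sum.inl j)), pow_one,
      Sum.elim_inl, if_pos hj, wordWeight, Sum.elim_inl]
  · rw [occurrences_eq_zero hj, pow_zero, Sum.elim_inl, if_neg hj, Nat.cast_one]

end IsSystem

end System

section Adjacency

open Matrix

variable {α : Type*} {X Y : List α}

theorem dropLast_eq_and_tail_eq_iff {v : List α} (hX : X ≠ []) (hY : Y ≠ []) :
    v.dropLast = X ∧ v.tail = Y ↔ v = star X Y ∧ X.tail = Y.dropLast := by
  obtain ⟨x, X, rfl⟩ := List.exists_cons_of_ne_nil hX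
  obtain ⟨Y, y, rfl⟩ := (List.eq_nil_or_concat' Y).resolve_left hY
  have hstar : star (x :: X) (Y ++ [y]) = x :: (X ++ [y]) := by
    simp [star]
  rw [hstar, List.tail_cons, List.dropLast_concat]
  constructor
  · rintro ⟨hdrop, htail⟩
    rcases v with _ | ⟨c, t⟩
    · exact absurd hdrop (List.cons_ne_nil x X).symm
    · rw [List.tail_cons] at htail
      subst htail
      rw [← List.cons_append, List.dropLast_concat] at hdrop
      obtain ⟨rfl, rfl⟩ := List.cons.inj hdrop
      exact ⟨rfl, rfl⟩
  · rintro ⟨rfl, rfl⟩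
    exact ⟨by rw [← List.cons_append, List.dropLast_concat], rfl⟩

theorem sum_ite_coe_eq {β : Type*} [DecidableEq β] (S : Set β) [Fintype S]
    [DecidablePred (· ∈ S)] (u : β) (t : ℝ) :
    ∑ v : S, (if (v : β) = u then t else 0) = if u ∈ S then t else 0 := by
  split_ifs with hu
  · rw [Finset.sum_eq_single ⟨u, hu⟩, if_pos rfl]
    · exact fun v _ hv => if_neg fun heq => hv (Subtype.ext heq)
    · exact fun hu' => absurd (Finset.mem_univ _) hu'
  · exact Finset.sum_eq_zero fun v _ => if_neg fun (heq : (v : β) = u) => hu (heq ▸ v.2)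

theorem sum_ite_dropLast_eq [Fintype α] [DecidableEq α] {S : Set (List α)} [Fintype S]
    [DecidablePred (· ∈ S)] (hS : [] ∉ S)
    (f : List α → ℝ) (X : List α) :
    ∑ v : S, (if (v : List α).dropLast = X then f v else 0) =
      ∑ y, if X ++ [y] ∈ S then f (X ++ [y]) else 0 := by
  simp only [← sum_ite_coe_eq]
  rw [Finset.sum_comm]
  refine Finset.sum_congr rfl fun ⟨v, hv⟩ _ => ?_
  obtain ⟨V, c, rfl⟩ := (List.eq_nil_or_concat' v).resolve_left fun h => hS (h ▸ hv)
  by_cases hVX : V = X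
  · simp [hVX]
  · simp [hVX]

theorem sum_ite_tail_eq [Fintype α] [DecidableEq α] {S : Set (List α)} [Fintype S]
    [DecidablePred (· ∈ S)] (hS : [] ∉ S)
    (f : List α → ℝ) (Y : List α) :
    ∑ v : S, (if (v : List α).tail = Y then f v else 0) =
      ∑ x, if x :: Y ∈ S then f (x :: Y) else 0 := by
  simp only [← sum_ite_coe_eq]
  rw [Finset.sum_comm]
  refine Finset.sum_congr rfl fun ⟨v, hv⟩ _ => ?_
  obtain ⟨c, V, rfl⟩ := List.exists_cons_of_ne_nil fun h : v = [] => hS (h ▸ hv)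
  by_cases hVY : V = Y
  · simp [hVY]
  · simp [hVY]

namespace IsSystem

variable {ι ι' : Type*} [Fintype α] [DecidableEq α] [Fintype ι] [Fintype ι'] {a : ι → List α}
  {r : ι' → List α} {m : ι' → ℕ} {p : ℕ} (h : IsSystem a r m p)

include h

open Classical in
theorem adjacency_apply (X Y : language a (p - 1)) :
    adjacency a r m p X Y = ∑ v : language a p,
      if (v : List α).dropLast = X ∧ (v : List α).tail = Y then
        weight (Sum.elim r a) (wordWeight m) v else 0 := by
  have hp := h.two_le
  have hne (Z : language a (p - 1)) : (Z : List α) ≠ [] :=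
    List.length_pos_iff.1 (by rw [Z.2.1]; omega)
  simp only [adjacency, Matrix.of_apply, dropLast_eq_and_tail_eq_iff (hne X) (hne Y)]
  by_cases hXY : (X : List α).tail = (Y : List α).dropLast
  · have hv (v : language a p) : (if (v : List α) = star X Y then
        weight (Sum.elim r a) (wordWeight m) v else 0) =
        if (v : List α) = star X Y then
          weight (Sum.elim r a) (wordWeight m) (star X Y) else 0 :=
      ite_congr rfl (fun heq => by rw [heq]) fun _ => rfl
    simp only [hXY, true_and, and_true, hv, sum_ite_coe_eq]
    exact ite_congr rfl (fun hmem => h.relMultiplicity_eq_weight hmem) fun _ => rfl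
  · simp only [hXY, false_and, and_false, if_false, Finset.sum_const_zero]

open Classical in
theorem adjacency_mulVec_apply (f : List α → ℝ) (X : language a (p - 1)) :
    (adjacency a r m p *ᵥ fun Y => f Y) X = ∑ y, if X.1 ++ [y] ∈ language a p then
      weight (Sum.elim r a) (wordWeight m) (X.1 ++ [y]) * f (X.1 ++ [y]).tail else 0 := by
  rw [← sum_ite_dropLast_eq h.nil_notMem_language
    fun v => weight (Sum.elim r a) (wordWeight m) v * f v.tail]
  simp only [Matrix.mulVec, dotProduct, h.adjacency_apply, Finset.sum_mul, ite_and, ite_mul,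
    zero_mul]
  rw [Finset.sum_comm]
  refine Finset.sum_congr rfl fun v _ => ?_
  split_ifs
  · have htail : v.1.tail ∈ language a (p - 1) := by
      have := mem_language_of_infix v.2 (List.tail_suffix v.1).isInfix
      rwa [List.length_tail, v.2.1] at this
    rw [Finset.sum_eq_single ⟨v.1.tail, htail⟩, if_pos rfl]
    · exact fun Y _ hY => if_neg fun heq => hY (Subtype.ext heq.symm)
    · exact fun hmem => absurd (Finset.mem_univ _) hmem
  · exact Finset.sum_const_zero

open Classical in
theorem vecMul_adjacency_apply (f : List α → ℝ) (Y : language a (p - 1)) :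
    ((fun X : language a (p - 1) => f X) ᵥ* adjacency a r m p) Y =
      ∑ x, if x :: Y.1 ∈ language a p then
        weight (Sum.elim r a) (wordWeight m) (x :: Y) * f (x :: Y.1).dropLast else 0 := by
  rw [← sum_ite_tail_eq h.nil_notMem_language
    fun v => weight (Sum.elim r a) (wordWeight m) v * f v.dropLast]
  simp only [Matrix.vecMul, dotProduct, h.adjacency_apply, Finset.mul_sum, mul_ite, mul_zero]
  rw [Finset.sum_comm]
  refine Finset.sum_congr rfl fun v _ => ?_
  by_cases htail : v.1.tail = Y
  · have hdrop : v.1.dropLast ∈ language a (p - 1) := by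
      have := mem_language_of_infix v.2 (List.dropLast_prefix v.1).isInfix
      rwa [List.length_dropLast, v.2.1] at this
    simp only [htail, and_true, if_true]
    rw [Finset.sum_eq_single ⟨v.1.dropLast, hdrop⟩, if_pos rfl, mul_comm]
    · exact fun X _ hX => if_neg fun heq => hX (Subtype.ext heq.symm)
    · exact fun hmem => absurd (Finset.mem_univ _) hmem
  · simp only [htail, and_false, if_false, Finset.sum_const_zero]

end IsSystem

end Adjacency

section Eigenvectors

open Matrix

theorem eq_zero_and_forall_pos_of_trichotomy {n ι : Type*} {w : n → ℝ} {d : ι → ℝ} {κ : ℝ}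
    (hw : w = 0 ∨ (∀ i, 0 < w i) ∨ ∀ i, w i < 0)
    (hnonneg : (∀ i, 0 ≤ w i) → 0 ≤ κ ∧ (κ = 0 → d = 0))
    (hnonpos : (∀ i, 0 ≤ -w i) → 0 ≤ -κ ∧ (-κ = 0 → -d = 0)) :
    (κ = 0 → d = 0) ∧ (0 < κ → ∀ i, 0 < w i) := by
  rcases hw with rfl | hpos | hneg
  · obtain ⟨hκ, -⟩ := hnonpos fun i => by rw [Pi.zero_apply, neg_zero]
    exact ⟨(hnonneg fun _ => le_rfl).2, fun hκ' => absurd hκ' (not_lt.2 (neg_nonneg.1 hκ))⟩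
  · exact ⟨(hnonneg fun i => (hpos i).le).2, fun _ => hpos⟩
  · obtain ⟨hκ, hd⟩ := hnonpos fun i => (neg_pos.2 (hneg i)).le
    exact ⟨fun h => neg_eq_zero.1 (hd (neg_eq_zero.2 h)),
      fun hκ' => absurd hκ' (not_lt.2 (neg_nonneg.1 hκ))⟩

variable {α ι ι' : Type*} [DecidableEq α] [Fintype ι] [Fintype ι']

/-- The potential read from right to left. The entries of `U` have this form. -/
noncomputable def leftPotential (w : ι → List α) (d : ι → ℝ) (κ z : ℝ) (X : List α) : ℝ :=
  potential (List.reverse ∘ w) d κ z X.reverse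

theorem leftPotential_neg (w : ι → List α) (d : ι → ℝ) (κ z : ℝ) (X : List α) :
    leftPotential w (-d) (-κ) z X = -leftPotential w d κ z X :=
  potential_neg _ d κ z _

variable [Fintype α] {w : ι → List α} {μ : ι → ℝ} {a : ι → List α} {r : ι' → List α}
  {m : ι' → ℕ} {p : ℕ} {d : ι → ℝ} {c : ι' ⊕ ι → ℝ} {κ z : ℝ} {X Y : List α}

theorem IsWeightedFamily.sum_weight_mul_leftPotential_dropLast (h : IsWeightedFamily w μ p)
    (hd : IsBalanced (List.reverse ∘ w) μ d κ z) (hY : Avoids w Y) (hlen : Y.length + 1 = p) :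
    ∑ x, weight w μ (x :: Y) * leftPotential w d κ z (x :: Y).dropLast =
      z * leftPotential w d κ z Y + defect α d κ z := by
  rw [leftPotential, ← h.reverse.sum_weight_mul_potential_tail hd (avoids_reverse_iff.2 hY)
    (by rwa [List.length_reverse])]
  refine Finset.sum_congr rfl fun x _ => ?_
  rw [← List.reverse_cons, weight_reverse, leftPotential, List.tail_reverse]

namespace IsSystem

variable (h : IsSystem a r m p)

include h

omit [DecidableEq α] [Fintype ι] [Fintype ι'] [Fintype α]

theorem pred_pos : 0 < p - 1 := Nat.sub_pos_of_lt h.two_le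

theorem length_le_pred_add_one (i : ι) : (a i).length ≤ p - 1 + 1 := by
  rw [Nat.sub_add_cancel (one_le_two.trans h.two_le)]
  exact h.length_le i

theorem length_add_one_of_mem_language (hX : X ∈ language a (p - 1)) : X.length + 1 = p := by
  rw [hX.1, Nat.sub_add_cancel (one_le_two.trans h.two_le)]

theorem avoids_elim_of_mem_language (hX : X ∈ language a (p - 1)) : Avoids (Sum.elim r a) X :=
  h.avoids_elim (avoids_of_mem_language hX) (h.length_add_one_of_mem_language hX).le

theorem cons_mem_language {x : α} (hY : Y ∈ language a (p - 1)) (hav : Avoids a (x :: Y)) :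
    x :: Y ∈ language a p := by
  have := RepeatedShift.cons_mem_language h.length_le_pred_add_one hY hav
  rwa [← hY.1, h.length_add_one_of_mem_language hY] at this

variable [DecidableEq α] [Fintype ι] [Fintype ι'] [Fintype α]

theorem potential_eq_zero_of_notMem_language
    (hc : IsBalanced (Sum.elim r a) (wordWeight m) c κ z) (hz : z ≠ 0)
    (hdef : defect α c κ z = 0) (hX : Avoids a X) (hlen : X.length + 1 = p)
    (hX' : X ∉ language a (p - 1)) : potential (Sum.elim r a) c κ z X = 0 := by
  suffices hpot : ∀ X : NotAllowed a (p - 1), Avoids a X.1 →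
      potential (Sum.elim r a) c κ z X = 0 from hpot ⟨X, by omega, hX'⟩ hX
  intro X
  induction X using
    (wellFounded_isStep_swap h.pred_pos h.length_le_pred_add_one).induction with
  | _ X ih =>
  intro hX
  have hp := h.two_le
  have hlen := X.2.1
  have hsum := h.isWeightedFamily.sum_weight_mul_potential_tail hc
    (h.avoids_elim hX (by omega)) (by omega)
  rw [hdef, add_zero, Finset.sum_eq_zero, eq_comm] at hsum
  · exact (mul_eq_zero.1 hsum).resolve_left hz
  intro y _
  by_cases hv : Avoids a (X ++ [y])
  · have hlen' : (X.1 ++ [y]).length = p - 1 + 1 := by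
      rw [List.length_append, hlen, List.length_singleton]
    have htail := tail_notMem_language h.length_le_pred_add_one hlen' hv
      (by rw [List.dropLast_concat]; exact X.2.2)
    rw [ih ⟨(X.1 ++ [y]).tail, by rw [List.length_tail, hlen', Nat.add_sub_cancel], htail⟩
      ⟨X ++ [y], hv, List.dropLast_concat, rfl⟩ hv.tail, mul_zero]
  · rw [weight_eq_zero_of_not_avoids hv, zero_mul]

theorem adjacency_mulVec_potential (hc : IsBalanced (Sum.elim r a) (wordWeight m) c κ z)
    (hz : z ≠ 0) (hdef : defect α c κ z = 0) :
    (adjacency a r m p *ᵥ fun X => potential (Sum.elim r a) c κ z X) =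
      z • fun X : language a (p - 1) => potential (Sum.elim r a) c κ z X := by
  classical
  ext X
  have hlen := h.length_add_one_of_mem_language X.2
  have hsum := h.isWeightedFamily.sum_weight_mul_potential_tail hc
    (h.avoids_elim_of_mem_language X.2) hlen
  rw [hdef, add_zero] at hsum
  rw [h.adjacency_mulVec_apply, Pi.smul_apply, smul_eq_mul, ← hsum]
  refine Finset.sum_congr rfl fun y _ => ite_eq_left_iff.2 fun hXy => ?_
  by_cases hav : Avoids a (X ++ [y])
  · rw [h.potential_eq_zero_of_notMem_language hc hz hdef hav.tail, mul_zero]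
    · simpa only [List.length_tail, List.length_append, List.length_singleton,
        Nat.add_sub_cancel] using hlen
    · intro htail
      obtain ⟨x, Y, hY⟩ := List.exists_cons_of_ne_nil (List.concat_ne_nil y X.1)
      rw [hY] at htail hav hXy
      exact hXy (h.cons_mem_language htail hav)
  · rw [weight_eq_zero_of_not_avoids hav, zero_mul]

theorem leftPotential_vecMul_adjacency
    (hc : IsBalanced (List.reverse ∘ Sum.elim r a) (wordWeight m) c κ z) :
    (fun X : language a (p - 1) => leftPotential (Sum.elim r a) c κ z X) ᵥ* adjacency a r m p =
      z • (fun X : language a (p - 1) => leftPotential (Sum.elim r a) c κ z X) +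
        Function.const _ (defect α c κ z) := by
  classical
  ext Y
  rw [h.vecMul_adjacency_apply, Pi.add_apply, Pi.smul_apply, smul_eq_mul, Function.const_apply,
    ← h.isWeightedFamily.sum_weight_mul_leftPotential_dropLast hc
      (h.avoids_elim_of_mem_language Y.2) (h.length_add_one_of_mem_language Y.2)]
  refine Finset.sum_congr rfl fun x _ => ite_eq_left_iff.2 fun hx => ?_
  rw [weight_eq_zero_of_not_avoids fun hav => hx (h.cons_mem_language Y.2 hav), zero_mul]

theorem leftPotential_nonneg
    (hc : IsBalanced (List.reverse ∘ Sum.elim r a) (wordWeight m) c κ z) (hz : 0 < z)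
    (hdef : defect α c κ z = 0)
    (hnonneg : ∀ X : language a (p - 1), 0 ≤ leftPotential (Sum.elim r a) c κ z X)
    (hX : Avoids a X) (hlen : X.length + 1 = p) :
    0 ≤ leftPotential (Sum.elim r a) c κ z X := by
  by_cases hX' : X ∈ language a (p - 1)
  · exact hnonneg ⟨X, hX'⟩
  suffices hpot : ∀ X : NotAllowed a (p - 1), Avoids a X.1 →
      0 ≤ leftPotential (Sum.elim r a) c κ z X from hpot ⟨X, by omega, hX'⟩ hX
  intro X
  induction X using (wellFounded_isStep h.pred_pos h.length_le_pred_add_one).induction with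
  | _ X ih =>
  intro hX
  have hp := h.two_le
  have hlen := X.2.1
  have hsum := h.isWeightedFamily.sum_weight_mul_leftPotential_dropLast hc
    (h.avoids_elim hX (by omega)) (by omega)
  rw [hdef, add_zero] at hsum
  refine nonneg_of_mul_nonneg_right (hsum ▸ Finset.sum_nonneg fun x _ => ?_) hz
  by_cases hv : Avoids a (x :: X)
  · refine mul_nonneg (weight_nonneg h.isWeightedFamily.nonneg _) ?_
    by_cases hdrop : (x :: X.1).dropLast ∈ language a (p - 1)
    · exact hnonneg ⟨_, hdrop⟩
    · have hlen' : (x :: X.1).dropLast.length = p - 1 := by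
        rw [List.length_dropLast, List.length_cons, hlen, Nat.add_sub_cancel]
      exact ih ⟨(x :: X.1).dropLast, hlen', hdrop⟩ ⟨x :: X, hv, rfl, rfl⟩ hv.dropLast
  · rw [weight_eq_zero_of_not_avoids hv, zero_mul]

theorem const_nonneg_of_potential_nonneg
    (hc : IsBalanced (Sum.elim r a) (wordWeight m) c κ z) (hz : 0 < z)
    (hdef : defect α c κ z = 0)
    (hnonneg : ∀ X : language a (p - 1), 0 ≤ potential (Sum.elim r a) c κ z X) :
    0 ≤ κ ∧ (κ = 0 → c = 0) := by
  refine h.isWeightedFamily.const_nonneg_and_eq_zero_imp hc hz hdef fun X hX hlen => ?_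
  by_cases hX' : X ∈ language a (p - 1)
  · exact hnonneg ⟨X, hX'⟩
  · exact (h.potential_eq_zero_of_notMem_language hc hz.ne' hdef
      (fun i => hX (Sum.inr i)) hlen hX').ge

theorem const_nonneg_of_leftPotential_nonneg
    (hc : IsBalanced (List.reverse ∘ Sum.elim r a) (wordWeight m) c κ z) (hz : 0 < z)
    (hdef : defect α c κ z = 0)
    (hnonneg : ∀ X : language a (p - 1), 0 ≤ leftPotential (Sum.elim r a) c κ z X) :
    0 ≤ κ ∧ (κ = 0 → c = 0) := by
  refine h.isWeightedFamily.reverse.const_nonneg_and_eq_zero_imp hc hz hdef fun X hX hlen => ?_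
  rw [← X.reverse_reverse] at hX ⊢
  exact h.leftPotential_nonneg hc hz hdef hnonneg
    (fun i => avoids_reverse_iff.1 hX (Sum.inr i)) (by rwa [List.length_reverse])

theorem potential_pos [Nonempty (language a (p - 1))] (hirr : (adjacency a r m p).IsIrreducible)
    (hc : IsBalanced (Sum.elim r a) (wordWeight m) c κ (perronRoot (adjacency a r m p)))
    (hdef : defect α c κ (perronRoot (adjacency a r m p)) = 0) (hκ : 0 < κ)
    (X : language a (p - 1)) :
    0 < potential (Sum.elim r a) c κ (perronRoot (adjacency a r m p)) X := by
  have hθ := (exists_pos_perronRoot_eigenvector hirr).1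
  refine (eq_zero_and_forall_pos_of_trichotomy (perronRoot_eigenvector_trichotomy hirr
    (h.adjacency_mulVec_potential hc hθ.ne' hdef))
    (h.const_nonneg_of_potential_nonneg hc hθ hdef) fun hneg =>
    h.const_nonneg_of_potential_nonneg hc.neg hθ (by rw [defect_neg, hdef, neg_zero])
      fun X => ?_).2 hκ X
  exact (hneg X).trans_eq (potential_neg _ _ _ _ _).symm

theorem defect_eq_zero [Nonempty (language a (p - 1))] (hirr : (adjacency a r m p).IsIrreducible)
    (hc : IsBalanced (List.reverse ∘ Sum.elim r a) (wordWeight m) c κ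
      (perronRoot (adjacency a r m p))) :
    defect α c κ (perronRoot (adjacency a r m p)) = 0 := by
  obtain ⟨-, v, hv, hAv⟩ := exists_pos_perronRoot_eigenvector hirr
  exact const_eq_zero_of_vecMul_eq hv hAv (h.leftPotential_vecMul_adjacency hc)

theorem coeff_eq_zero_and_leftPotential_pos [Nonempty (language a (p - 1))]
    (hirr : (adjacency a r m p).IsIrreducible)
    (hc : IsBalanced (List.reverse ∘ Sum.elim r a) (wordWeight m) c κ
      (perronRoot (adjacency a r m p))) :
    (κ = 0 → c = 0) ∧ (0 < κ → ∀ X : language a (p - 1),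
      0 < leftPotential (Sum.elim r a) c κ (perronRoot (adjacency a r m p)) X) := by
  have hθ := (exists_pos_perronRoot_eigenvector hirr).1
  have hdef := h.defect_eq_zero hirr hc
  have hvec := h.leftPotential_vecMul_adjacency hc
  rw [hdef, Function.const_zero, add_zero] at hvec
  refine eq_zero_and_forall_pos_of_trichotomy (perronRoot_left_eigenvector_trichotomy hirr hvec)
    (h.const_nonneg_of_leftPotential_nonneg hc hθ hdef) fun hneg =>
    h.const_nonneg_of_leftPotential_nonneg hc.neg hθ (by rw [defect_neg, hdef, neg_zero])
      fun X => ?_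
  exact (hneg X).trans_eq (leftPotential_neg _ _ _ _ _).symm

end IsSystem

end Eigenvectors

section LinearSystems

open Matrix

theorem sum_mul_eq_of_diagonal_mul_eq {n : Type*} [Fintype n] [DecidableEq n]
    {P Q : Matrix n n ℝ} {d R S : n → ℝ} (hPQ : diagonal d * Q = Pᵀ * diagonal d)
    (hR : P *ᵥ R = 1) (hS : Q *ᵥ S = 1) : ∑ i, d i * R i = ∑ i, d i * S i :=
  calc ∑ i, d i * R i = R ⬝ᵥ diagonal d *ᵥ Q *ᵥ S := by
        simp only [hS, dotProduct, mulVec_diagonal, Pi.one_apply, mul_one, mul_comm]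
    _ = P *ᵥ R ⬝ᵥ diagonal d *ᵥ S := by
        rw [mulVec_mulVec, hPQ, ← mulVec_mulVec, dotProduct_mulVec, vecMul_transpose]
    _ = ∑ i, d i * S i := by
        simp only [hR, one_dotProduct, mulVec_diagonal]

section SystemMatrix

variable {α ι ι' : Type*} [DecidableEq α]

/-- The matrix of the correlations of the words of a family. -/
def correlationMatrix (w : ι → List α) (z : ℝ) : Matrix ι ι ℝ :=
  Matrix.of fun i j => correlation (w i) (w j) z

/-- The diagonal of `D(z)`. -/
noncomputable def diagD (m : ι' → ℕ) (z : ℝ) : ι' ⊕ ι → ℝ :=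
  Sum.elim (fun i => z * (1 - 1 / (m i : ℝ))) (fun _ => -z)

/-- The matrix `Q(z)` of the family `w`, with `D(z)⁻¹` cancelled. For the reversed words it
is `P(z)`. -/
noncomputable def systemMatrix [Fintype ι] [DecidableEq ι] [Fintype ι'] [DecidableEq ι']
    (w : ι' ⊕ ι → List α) (m : ι' → ℕ) (p : ℕ) (z : ℝ) : Matrix (ι' ⊕ ι) (ι' ⊕ ι) ℝ :=
  correlationMatrix w z * diagonal (diagD m z) - diagonal (Sum.elim (fun _ => z ^ p) 0)

theorem diagD_ne_zero {m : ι' → ℕ} {z : ℝ} (hm : ∀ j, 2 ≤ m j) (hz : z ≠ 0) (i : ι' ⊕ ι) :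
    diagD m z i ≠ 0 := by
  rcases i with j | _
  · refine mul_ne_zero hz (sub_ne_zero.2 fun heq => ?_)
    rw [one_div, eq_comm, inv_eq_one, Nat.cast_eq_one] at heq
    exact absurd (heq ▸ hm j) (by decide)
  · exact neg_ne_zero.2 hz

theorem IsWeightedFamily.correlationMatrix_reverse {w : ι → List α} {μ : ι → ℝ} {p : ℕ}
    (h : IsWeightedFamily w μ p) (z : ℝ) :
    correlationMatrix (List.reverse ∘ w) z = (correlationMatrix w z)ᵀ := by
  ext i j
  have hlen {k l : ι} (hkl : w k <:+: w l) : (w l).length ≤ (w k).length :=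
    h.reduced k l hkl ▸ le_rfl
  exact correlation_reverse (u := w j) (v := w i) hlen hlen z

variable [Fintype ι] [DecidableEq ι] [Fintype ι'] [DecidableEq ι'] {w : ι' ⊕ ι → List α}
  {m : ι' → ℕ} {p : ℕ} {c : ι' ⊕ ι → ℝ} {κ z : ℝ}

theorem potential_word_of_systemMatrix_mulVec (hc : systemMatrix w m p z *ᵥ c = Function.const _ κ)
    (i : ι' ⊕ ι) :
    potential w (diagD m z * c) κ z (w i) = -(Sum.elim (fun _ => z ^ p) 0 i * c i) := by
  have hi := congrFun hc i
  have hD : diagonal (diagD m z) *ᵥ c = diagD m z * c := funext (mulVec_diagonal _ _)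
  rw [systemMatrix, sub_mulVec, Pi.sub_apply, mulVec_diagonal, ← mulVec_mulVec, hD,
    Function.const_apply] at hi
  rw [potential, ← hi]
  simp only [mulVec, dotProduct, correlationMatrix, of_apply, mul_comm (correlation _ _ _)]
  ring

theorem IsWeightedFamily.isBalanced_of_systemMatrix_mulVec
    (h : IsWeightedFamily w (wordWeight m) p) (hm : ∀ j, m j ≠ 0)
    (hc : systemMatrix w m p z *ᵥ c = Function.const _ κ) :
    IsBalanced w (wordWeight m) (diagD m z * c) κ z := by
  rintro (j | i)
  · have hmj : (m j : ℝ) ≠ 0 := Nat.cast_ne_zero.2 (hm j)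
    have htail := h.potential_word (d := diagD m z * c) (κ := κ) (z := z) (Sum.inl j)
    rw [potential_word_of_systemMatrix_mulVec hc, List.length_tail,
      h.length_eq (Sum.inl j) hmj] at htail
    rw [potential_word_of_systemMatrix_mulVec hc, eq_add_of_sub_eq htail.symm, Sum.elim_inl,
      wordWeight, Sum.elim_inl, Pi.mul_apply, diagD, Sum.elim_inl,
      ← Nat.sub_add_cancel h.pos, Nat.add_sub_cancel]
    field_simp
    ring
  · rw [potential_word_of_systemMatrix_mulVec hc, wordWeight, Sum.elim_inr, Sum.elim_inr,
      Pi.zero_apply, zero_mul, zero_mul, neg_zero]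

end SystemMatrix

variable {α : Type*} [DecidableEq α] {s ℓ : ℕ} {a : Fin s → List α} {r : Fin ℓ → List α}
  {m : Fin ℓ → ℕ} {p : ℕ} {z : ℝ} {X : List α}

theorem vecV_eq_potential (X : List α) :
    vecV a r m z X = potential (Sum.elim r a) (diagD m z * rowS a r m z) 1 z X := by
  simp only [vecV, potential, diagD, Fintype.sum_sum_type, Sum.elim_inl, Sum.elim_inr,
    Finset.mul_sum, Pi.mul_apply, neg_mul, Finset.sum_neg_distrib, mul_assoc]
  ring

theorem matP_mulVec_rowR (hP : IsUnit (matP a r m z).det) :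
    matP a r m z *ᵥ rowR a r m z = 1 := by
  have hR : rowR a r m z = (matP a r m z)⁻¹ *ᵥ 1 := funext fun i => (dotProduct_one _).symm
  rw [hR, mulVec_mulVec, mul_nonsing_inv _ hP, one_mulVec]

theorem matQ_mulVec_rowS (hQ : IsUnit (matQ a r m z).det) :
    matQ a r m z *ᵥ rowS a r m z = 1 := by
  have hS : rowS a r m z = (matQ a r m z)⁻¹ *ᵥ 1 := funext fun i => (dotProduct_one _).symm
  rw [hS, mulVec_mulVec, mul_nonsing_inv _ hQ, one_mulVec]

theorem isUnit_det_matD (hm : ∀ j, 2 ≤ m j) (hz : z ≠ 0) : IsUnit (matD s m z).det := by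
  rw [matD, det_diagonal]
  exact (Finset.prod_ne_zero_iff.2 fun i _ => diagD_ne_zero hm hz i).isUnit

theorem matD_mul_matQ (hm : ∀ j, 2 ≤ m j) (hz : z ≠ 0) :
    matD s m z * matQ a r m z = (matP a r m z)ᵀ * matD s m z := by
  rw [matQ, Matrix.mul_assoc, mul_nonsing_inv_cancel_left _ _ (isUnit_det_matD hm hz)]

theorem det_matQ (hm : ∀ j, 2 ≤ m j) (hz : z ≠ 0) :
    (matQ a r m z).det = (matP a r m z).det := by
  have hdet := congrArg det (matD_mul_matQ (a := a) (r := r) hm hz)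
  rw [det_mul, det_mul, det_transpose, mul_comm] at hdet
  exact (isUnit_det_matD hm hz).mul_right_cancel hdet

theorem isUnit_det_matQ (hm : ∀ j, 2 ≤ m j) (hz : z ≠ 0) (hP : IsUnit (matP a r m z).det) :
    IsUnit (matQ a r m z).det := by
  rwa [det_matQ hm hz]

theorem sum_diagD_mul_rowR (hm : ∀ j, 2 ≤ m j) (hz : z ≠ 0) (hP : IsUnit (matP a r m z).det) :
    ∑ i, diagD m z i * rowR a r m z i = ∑ i, diagD m z i * rowS a r m z i :=
  sum_mul_eq_of_diagonal_mul_eq (matD_mul_matQ hm hz) (matP_mulVec_rowR hP)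
    (matQ_mulVec_rowS (isUnit_det_matQ hm hz hP))

namespace IsSystem

variable (h : IsSystem a r m p)

include h

theorem vecU_eq_leftPotential (hX : Avoids a X) (hlen : X.length + 1 = p) :
    vecU a r m z X = leftPotential (Sum.elim r a) (diagD m z * rowR a r m z) 1 z X := by
  have hcorr (i : Fin ℓ ⊕ Fin s) : correlation (Sum.elim r a i).tail X z =
      correlation X.reverse (Sum.elim r a i).reverse z :=
    correlation_tail_eq_reverse (hlen.symm ▸ h.length_word_le i)
      (h.avoids_elim hX (by omega) i) z
  have hr (j : Fin ℓ) : correlation (r j).tail X z = _ := hcorr (Sum.inl j)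
  have ha (i : Fin s) : correlation (a i).tail X z = _ := hcorr (Sum.inr i)
  simp only [vecU, leftPotential, potential, diagD, Fintype.sum_sum_type, Sum.elim_inl,
    Sum.elim_inr, Function.comp_apply, Finset.mul_sum, Pi.mul_apply, hr, ha, neg_mul,
    Finset.sum_neg_distrib, mul_assoc]
  ring

theorem matP_eq_systemMatrix (z : ℝ) :
    matP a r m z = systemMatrix (List.reverse ∘ Sum.elim r a) m p z := by
  rw [systemMatrix, h.isWeightedFamily.correlationMatrix_reverse]
  ext (i | i) (j | j) <;>
    simp [matP, correlationMatrix, diagD, mul_diagonal, diagonal_apply, h.length_eq,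
      mul_comm (correlation _ _ _)]

theorem matQ_eq_systemMatrix (hz : z ≠ 0) :
    matQ a r m z = systemMatrix (Sum.elim r a) m p z := by
  have hD := isUnit_det_matD (s := s) h.two_le_mult hz
  refine ((isUnit_iff_isUnit_det _).2 hD).mul_left_cancel ?_
  rw [matD_mul_matQ h.two_le_mult hz, h.matP_eq_systemMatrix, systemMatrix, systemMatrix,
    h.isWeightedFamily.correlationMatrix_reverse, transpose_sub, transpose_mul,
    transpose_transpose, diagonal_transpose, diagonal_transpose, Matrix.sub_mul, Matrix.mul_sub,
    Matrix.mul_assoc]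
  exact congrArg _ (commute_diagonal _ _)

theorem isBalanced_of_matP_mulVec {c : Fin ℓ ⊕ Fin s → ℝ} {κ : ℝ}
    (hc : matP a r m z *ᵥ c = Function.const _ κ) :
    IsBalanced (List.reverse ∘ Sum.elim r a) (wordWeight m) (diagD m z * c) κ z :=
  h.isWeightedFamily.reverse.isBalanced_of_systemMatrix_mulVec
    (fun j => (zero_lt_two.trans_le (h.two_le_mult j)).ne') (h.matP_eq_systemMatrix z ▸ hc)

theorem isBalanced_of_matQ_mulVec (hz : z ≠ 0) {c : Fin ℓ ⊕ Fin s → ℝ} {κ : ℝ}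
    (hc : matQ a r m z *ᵥ c = Function.const _ κ) :
    IsBalanced (Sum.elim r a) (wordWeight m) (diagD m z * c) κ z :=
  h.isWeightedFamily.isBalanced_of_systemMatrix_mulVec
    (fun j => (zero_lt_two.trans_le (h.two_le_mult j)).ne') (h.matQ_eq_systemMatrix hz ▸ hc)

theorem isUnit_det_matP [Fintype α] [Nonempty (language a (p - 1))]
    (hirr : (adjacency a r m p).IsIrreducible) :
    IsUnit (matP a r m (perronRoot (adjacency a r m p))).det := by
  have hθ := (exists_pos_perronRoot_eigenvector hirr).1
  refine isUnit_iff_ne_zero.2 fun hdet => ?_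
  obtain ⟨c, hc, hPc⟩ := exists_mulVec_eq_zero_iff.2 hdet
  have hzero := (h.coeff_eq_zero_and_leftPotential_pos hirr
    (h.isBalanced_of_matP_mulVec (κ := 0) hPc)).1 rfl
  exact hc (funext fun i =>
    (mul_eq_zero.1 (congrFun hzero i)).resolve_left (diagD_ne_zero h.two_le_mult hθ.ne' i))

end IsSystem

end LinearSystems

theorem nonempty_language {α ι : Type*} {a : ι → List α} (h : (subshift a).Nonempty) (n : ℕ) :
    Nonempty (language a n) :=
  h.elim fun x hx => ⟨⟨block x 0 n, length_block x 0 n, x, hx, 0, rfl⟩⟩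

theorem mainTheorem8_general {α : Type*} [Fintype α] [DecidableEq α] {s ℓ : ℕ}
    (a : Fin s → List α) (r : Fin ℓ → List α) (m : Fin ℓ → ℕ) (p : ℕ) (h : IsSystem a r m p)
    (hne : (subshift a).Nonempty) (hirr : (adjacency a r m p).IsIrreducible) :
    let A := adjacency a r m p
    let θ := perronRoot A
    let U : language a (p - 1) → ℝ := fun X => vecU a r m θ X
    let V : language a (p - 1) → ℝ := fun X => vecV a r m θ X
    IsUnit (matP a r m θ).det ∧ IsUnit (matQ a r m θ).det ∧
      (∀ X, 0 < U X) ∧ Matrix.vecMul U A = θ • U ∧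
      (∀ X, 0 < V X) ∧ Matrix.mulVec A V = θ • V := by
  intro A θ U V
  have := nonempty_language hne (p - 1)
  have hθ : 0 < θ := (exists_pos_perronRoot_eigenvector hirr).1
  have hP : IsUnit (matP a r m θ).det := h.isUnit_det_matP hirr
  have hQ : IsUnit (matQ a r m θ).det := isUnit_det_matQ h.two_le_mult hθ.ne' hP
  have hR := h.isBalanced_of_matP_mulVec (κ := 1) (matP_mulVec_rowR hP)
  have hS := h.isBalanced_of_matQ_mulVec (κ := 1) hθ.ne' (matQ_mulVec_rowS hQ)
  have hdefR : defect α (diagD m θ * rowR a r m θ) 1 θ = 0 := h.defect_eq_zero hirr hR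
  have hdefS : defect α (diagD m θ * rowS a r m θ) 1 θ = 0 := by
    rw [← hdefR]
    exact congrArg _ (sum_diagD_mul_rowR h.two_le_mult hθ.ne' hP).symm
  have hU : U = fun X : language a (p - 1) =>
      leftPotential (Sum.elim r a) (diagD m θ * rowR a r m θ) 1 θ X := funext fun X =>
    h.vecU_eq_leftPotential (avoids_of_mem_language X.2) (h.length_add_one_of_mem_language X.2)
  have hV : V = fun X : language a (p - 1) =>
      potential (Sum.elim r a) (diagD m θ * rowS a r m θ) 1 θ X :=
    funext fun X => vecV_eq_potential X.1
  rw [hU, hV]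
  refine ⟨hP, hQ, (h.coeff_eq_zero_and_leftPotential_pos hirr hR).2 one_pos, ?_,
    h.potential_pos hirr hS hdefS one_pos, h.adjacency_mulVec_potential hS hθ.ne' hdefS⟩
  simpa only [hdefR, Function.const_zero, add_zero] using h.leftPotential_vecMul_adjacency hR

end RepeatedShift

open RepeatedShift in
theorem mainTheorem8 {α : Type*} [Fintype α] [DecidableEq α] (hq : 2 ≤ Fintype.card α)
    {s ℓ : ℕ} (a : Fin s → List α) (r : Fin ℓ → List α) (m : Fin ℓ → ℕ) (p : ℕ)
    (ha_len : ∀ i, 2 ≤ (a i).length) (ha_red : IsReduced a)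
    (h_symb : ∀ x : α, IsAllowed a [x])
    (hr_allowed : ∀ j, IsAllowed a (r j)) (hr_red : IsReduced r) (hm : ∀ j, 2 ≤ m j)
    (hp : IsGreatest (Set.range (fun i => (a i).length) ∪ Set.range (fun j => (r j).length)) p)
    (hp_two : 2 ≤ p) (hr_len : ∀ j, (r j).length = p)
    (h_irr : (adjacency a r m p).IsIrreducible) :
    let A := adjacency a r m p
    let θ := perronRoot A
    let U : language a (p - 1) → ℝ := fun X => vecU a r m θ X
    let V : language a (p - 1) → ℝ := fun X => vecV a r m θ X
    IsUnit (matP a r m θ).det ∧ IsUnit (matQ a r m θ).det ∧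
      (∀ X, 0 < U X) ∧ Matrix.vecMul U A = θ • U ∧
      (∀ X, 0 < V X) ∧ Matrix.mulVec A V = θ • V := by
  have hallowed (x : α) : ∃ ξ, ξ ∈ subshift a := (h_symb x).2.imp fun _ hξ => hξ.1
  have hα : Nonempty α := Fintype.card_pos_iff.1 (zero_lt_two.trans_le hq)
  exact mainTheorem8_general a r m p
    { two_le := hp_two
      ne_nil := fun i => List.length_pos_iff.1 (zero_lt_two.trans_le (ha_len i))
      length_le := fun i => hp.2 (Or.inl ⟨i, rfl⟩)
      length_eq := hr_len
      two_le_mult := hm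
      reduced_forbidden := ha_red
      reduced_repeated := hr_red
      avoids := fun j => avoids_of_mem_language (hr_allowed j) } (hα.elim hallowed) h_irr
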